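/- Let $k\ge 0$ and let $\beta=\sigma_{i_1}\cdots\sigma_{i_r}$ be a positive braid word on $k$ strands. A complete flag in $\mathbb C^k$ is written $\mathcal F=(0\subset F_1\subset\cdots\subset F_k=\mathbb C^k)$. For $M\in \mathrm{GL}_k(\mathbb C)$ let $\mathcal F(M)$ be the flag whose $i$-th space is spanned by the first $i$ columns of $M$. For $u\in S_k$ let $\mathcal F(u)$ be the coordinate flag with $i$-th space $\langle e_{u(1)},\dots,e_{u(i)}\rangle$; it is the flag of the permutation matrix of $u$, also denoted $u$. Let $w_0$ be the longest element of $S_k$, $\mathcal F^{\mathrm{std}}=\mathcal F(e)$ and $\mathcal F^{\mathrm{ant}}=\mathcal F(w_0)$. Two flags $\mathcal F,\mathcal F'$ are in relative position $u$ if $g\mathcal F=\mathcal F^{\mathrm{std}}$, $g\mathcal F'=\mathcal F(u)$ for some $g\in \mathrm{GL}_k(\mathbb C)$; they are transverse, $\mathcal F\pitchfork\mathcal F'$, if they are in relative position $w_0$. The braid variety $X(\beta)$ is the variety of tuples $(\mathcal F^0,\dots,\mathcal F^r)$ of flags with $\mathcal F^0=\mathcal F^{\mathrm{std}}$, $\mathcal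 F^r=\mathcal F^{\mathrm{ant}}$ and $\mathcal F^{j-1},\mathcal F^{j}$ in relative position $s_{i_j}$ for $1\le j\le r$, with its reduced structure as a subvariety of a product of flag varieties. The Demazure product $\delta$ of a word is defined by $\delta(\emptyset)=e$, and $\delta(\gamma\sigma_i)=\delta(\gamma)s_i$ if this is longer than $\delta(\gamma)$, and $\delta(\gamma\sigma_i)=\delta(\gamma)$ otherwise. Assume $\delta(\beta)=w_0$. Let $1\le r_1\le r$, $\beta^1=\sigma_{i_1}\cdots\sigma_{i_{r_1}}$ and $\beta^2=\sigma_{i_{r_1+1}}\cdots\sigma_{i_r}$. For $w\in S_k$ put $$\mathcal U_{r_1,w}=\{(\mathcal F^0,\dots,\mathcal F^r)\in X(\beta)\mid \mathcal F^{r_1}\pitchfork \mathcal F(w_0w)\}.$$ **Theorem.** (1) For every $w\in S_k$, the set $\mathcal U_{r_1,w}$ is a principal open subset of $X(\beta)$, i.e. the nonvanishing locus of a regular function on $X(\beta)$. (2) Let $w\in S_k$, and let $\underline{w}=\sigma_{a_1}\cdots\sigma_{a_m}$ and $\underline{w^{-1}w_0}=\sigma_{b_1}\cdots\sigma_{b_n}$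 be any reduced words of $w$ and $w^{-1}w_0$ (representing their braid lifts of minimal length). Then there is an isomorphism of algebraic varieties $$\Psi_{r_1,w}:X(\underline{w^{-1}w_0}\,\beta^1)\times X(\beta^2\,\underline{w})\xrightarrow{\ \cong\ }\mathcal U_{r_1,w}.$$ Its inverse $\Phi_{r_1,w}=(\Phi^1,\Phi^2)$ is the following map. For $(\mathcal F^0,\dots,\mathcal F^r)\in\mathcal U_{r_1,w}$ write $\mathcal F^{r_1}=\mathcal F(w_0ww_0L)$ with $L$ lower triangular with ones on the diagonal, and put $g_2=(w_0ww_0L)^{-1}$, $g_1=w_0g_2$. Then $$\Phi^1=g_1\big(\mathcal F(w_0w),\,\mathcal F(w_0ws_{b_1}),\,\dots,\,\mathcal F(w_0ws_{b_1}\cdots s_{b_n})=\mathcal F^{\mathrm{std}}=\mathcal F^0,\,\mathcal F^1,\dots,\mathcal F^{r_1}\big),$$ $$\Phi^2=g_2\big(\mathcal F^{r_1},\dots,\mathcal F^{r}=\mathcal F(w_0),\,\mathcal F(w_0s_{a_1}),\,\dots,\,\mathcal F(w_0s_{a_1}\cdots s_{a_m})=\mathcal F(w_0w)\big).$$ (3)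 $\bigcup_{w\in S_k}\mathcal U_{r_1,w}=X(\beta)$. -/

import Mathlib

namespace BraidSplicing

/-! ### Permutations and braid words

The strands are indexed by `Fin k`, the generators `σ_i` by `Fin (k - 1)`, and a positive braid is
given by a word in the generators. -/

/-- The simple transposition `s_i`, exchanging the positions `i` and `i + 1`. -/
def simpleTransposition {k : ℕ} (i : Fin (k - 1)) : Equiv.Perm (Fin k) :=
  Equiv.swap ⟨i, by omega⟩ ⟨i + 1, by omega⟩

/-- The permutation `s_{i_1} ⋯ s_{i_r}` of the braid word `σ_{i_1} ⋯ σ_{i_r}`. -/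
def wordPerm {k : ℕ} (β : List (Fin (k - 1))) : Equiv.Perm (Fin k) :=
  (β.map simpleTransposition).prod

/-- The Coxeter length: the least length of a word in the simple transpositions with product `w`. -/
noncomputable def permLength {k : ℕ} (w : Equiv.Perm (Fin k)) : ℕ :=
  sInf {n : ℕ | ∃ β : List (Fin (k - 1)), β.length = n ∧ wordPerm β = w}

/-- `a` is a reduced word of `w`, i.e. a word for the braid lift of `w` of minimal length. -/
def IsReducedWord {k : ℕ} (a : List (Fin (k - 1))) (w : Equiv.Perm (Fin k)) : Prop :=
  wordPerm a = w ∧ a.length = permLength w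

/-- The longest element `w₀` of the symmetric group, reversing the order of `Fin k`. -/
def longest (k : ℕ) : Equiv.Perm (Fin k) := Fin.revPerm

/-- The Demazure product `δ`: reading the word from left to right, `u` is replaced by `u s_i` if
this is longer than `u`, and kept otherwise. -/
noncomputable def demazure {k : ℕ} (β : List (Fin (k - 1))) : Equiv.Perm (Fin k) :=
  β.foldl (fun u i =>
    if permLength u < permLength (u * simpleTransposition i) then u * simpleTransposition i
    else u) 1

/-! ### Complete flags -/

/-- A complete flag `0 = F_0 ⊆ F_1 ⊆ ⋯ ⊆ F_k = ℂ^k` with `dim F_i = i`. -/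
@[ext]
structure CompleteFlag (k : ℕ) where
  sub : Fin (k + 1) → Submodule ℂ (Fin k → ℂ)
  mono : Monotone sub
  finrank_sub : ∀ i, Module.finrank ℂ (sub i) = i

/-- The flag `F(M)`, whose `i`-th subspace is spanned by the first `i` columns of `M`. -/
def flagOf {k : ℕ} (M : Matrix.GeneralLinearGroup (Fin k) ℂ) : CompleteFlag k where
  sub i := Submodule.span ℂ ((fun j a => M.val a j) '' {j : Fin k | (j : ℕ) < i})
  mono i i' h := Submodule.span_mono (Set.image_mono fun j hj =>
    Nat.lt_of_lt_of_le (show (j : ℕ) < i from hj) h)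
  finrank_sub i := by
    have hli : LinearIndependent ℂ (fun j a => M.val a j) :=
      Matrix.linearIndependent_cols_iff_isUnit.mpr M.isUnit
    classical
    have h := finrank_span_set_eq_card
      ((hli.linearIndepOn {j : Fin k | (j : ℕ) < i}).id_image)
    rw [Set.toFinset_card] at h
    rw [h, Set.card_image_of_injective _ hli.injective]
    have hi : (i : ℕ) ≤ k := Nat.lt_succ_iff.mp i.isLt
    rw [Fintype.card_subtype]
    simpa only [min_eq_right hi, Set.mem_ofPred_eq] using Fin.card_filter_val_lt (n := k) (m := (i : ℕ))

/-- The general linear group acts on flags by `g (F_0 ⊆ F_1 ⊆ ⋯) = (g F_0 ⊆ g F_1 ⊆ ⋯)`. -/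
instance {k : ℕ} : MulAction (Matrix.GeneralLinearGroup (Fin k) ℂ) (CompleteFlag k) where
  smul g F :=
    { sub := fun i => (F.sub i).map (Matrix.mulVecLin g.val)
      mono := fun _ _ h => Submodule.map_mono (F.mono h)
      finrank_sub := fun i => by
        rw [← F.finrank_sub i]
        exact (Submodule.equivMapOfInjective _
          (Matrix.mulVec_injective_iff_isUnit.mpr g.isUnit) _).finrank_eq.symm }
  one_smul F := by
    ext1
    funext i
    change (F.sub i).map (Matrix.mulVecLin 1) = F.sub i
    rw [Matrix.mulVecLin_one, Submodule.map_id]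
  mul_smul g h F := by
    ext1
    funext i
    change (F.sub i).map (Matrix.mulVecLin (g.val * h.val)) =
      ((F.sub i).map (Matrix.mulVecLin h.val)).map (Matrix.mulVecLin g.val)
    rw [Matrix.mulVecLin_mul, Submodule.map_comp]

/-- The permutation matrix of `w`, whose `j`-th column is `e_{w(j)}`. -/
def permGL {k : ℕ} (w : Equiv.Perm (Fin k)) : Matrix.GeneralLinearGroup (Fin k) ℂ where
  val := Matrix.of fun i j => if i = w j then 1 else 0
  inv := Matrix.of fun i j => if i = w⁻¹ j then 1 else 0
  val_inv := by
    ext i j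
    simp [Matrix.mul_apply, Matrix.one_apply]
  inv_val := by
    ext i j
    simp [Matrix.mul_apply, Matrix.one_apply]

/-- The coordinate flag `F(w)`, whose `i`-th subspace is spanned by `e_{w(1)}, …, e_{w(i)}`. -/
def coordFlag {k : ℕ} (w : Equiv.Perm (Fin k)) : CompleteFlag k := flagOf (permGL w)

/-- The standard flag. -/
def stdFlag (k : ℕ) : CompleteFlag k := coordFlag 1

/-- The antistandard flag. -/
def antFlag (k : ℕ) : CompleteFlag k := coordFlag (longest k)

/-- The flags `F` and `F'` are in relative position `w`. -/
def RelPos {k : ℕ} (F : CompleteFlag k) (w : Equiv.Perm (Fin k)) (F' : CompleteFlag k) : Prop :=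
  ∃ g : Matrix.GeneralLinearGroup (Fin k) ℂ, g • F = stdFlag k ∧ g • F' = coordFlag w

/-- Two flags are transverse if they are in relative position `w₀`. -/
def Transverse {k : ℕ} (F F' : CompleteFlag k) : Prop := RelPos F (longest k) F'

/-! ### Varieties of tuples of flags

For a finite index set `ι`, the product `Fl_k^ι` of flag varieties is the quotient of `GL_k^ι` by
the product of the Borel subgroups, via `M ↦ F(M)`. So a set of tuples of flags is open, and a
function on it regular, exactly if its pullback to tuples of matrices is so. Subsets
`S` of `Fl_k^ι` carry the induced (reduced) structure; only locally closed ones occur below. -/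

/-- The tuple of flags of a tuple of matrices. -/
def flagTuple {k : ℕ} {ι : Type} (m : ι → Matrix.GeneralLinearGroup (Fin k) ℂ) :
    ι → CompleteFlag k := fun i => flagOf (m i)

/-- The value of a polynomial in the matrix entries at a tuple of matrices. -/
noncomputable def evalAt {k : ℕ} {ι : Type} (m : ι → Matrix.GeneralLinearGroup (Fin k) ℂ)
    (p : MvPolynomial (ι × Fin k × Fin k) ℂ) : ℂ :=
  MvPolynomial.eval (fun c => (m c.1).val c.2.1 c.2.2) p

/-- The Zariski topology on a set `S` of tuples of flags. -/
abbrev zariski {k : ℕ} {ι : Type} (S : Set (ι → CompleteFlag k)) : TopologicalSpace S where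
  IsOpen V := ∀ m (hm : flagTuple m ∈ S), (⟨flagTuple m, hm⟩ : S) ∈ V →
    ∃ h, evalAt m h ≠ 0 ∧
      ∀ n (hn : flagTuple n ∈ S), evalAt n h ≠ 0 → (⟨flagTuple n, hn⟩ : S) ∈ V
  isOpen_univ _ _ _ := ⟨1, by simp [evalAt], fun _ _ _ => trivial⟩
  isOpen_inter V W hV hW m hm hmem := by
    obtain ⟨h, h1, h2⟩ := hV m hm hmem.1
    obtain ⟨h', h1', h2'⟩ := hW m hm hmem.2
    refine ⟨h * h', ?_, fun n hn hne => ?_⟩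
    · simp only [evalAt, map_mul] at h1 h1' ⊢
      exact mul_ne_zero h1 h1'
    · simp only [evalAt, map_mul] at hne
      exact ⟨h2 n hn (left_ne_zero_of_mul hne), h2' n hn (right_ne_zero_of_mul hne)⟩
  isOpen_sUnion s hs m hm hmem := by
    obtain ⟨V, hV, hmV⟩ := hmem
    obtain ⟨h, h1, h2⟩ := hs V hV m hm hmV
    exact ⟨h, h1, fun n hn hne => ⟨V, hV, h2 n hn hne⟩⟩

/-- `f` is regular on the subset `V` of `S`: locally it is a quotient of polynomials in the entries
of matrices representing the flags. Only the values of `f` on `V` matter. -/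
def IsRegularOn {k : ℕ} {ι : Type} {S : Set (ι → CompleteFlag k)} (V : Set S) (f : S → ℂ) : Prop :=
  ∀ m (hm : flagTuple m ∈ S), (⟨flagTuple m, hm⟩ : S) ∈ V →
    ∃ g h, evalAt m h ≠ 0 ∧
      ∀ n (hn : flagTuple n ∈ S), (⟨flagTuple n, hn⟩ : S) ∈ V → evalAt n h ≠ 0 →
        f ⟨flagTuple n, hn⟩ = evalAt n g / evalAt n h

/-- A morphism of varieties: a Zariski continuous map that pulls back regular functions on open
sets to regular functions. -/
def IsMorphism {k : ℕ} {ι κ : Type} {S : Set (ι → CompleteFlag k)} {T : Set (κ → CompleteFlag k)}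
    (φ : S → T) : Prop :=
  @Continuous S T (zariski S) (zariski T) φ ∧
    ∀ (V : Set T) (f : T → ℂ), @IsOpen T (zariski T) V → IsRegularOn V f →
      IsRegularOn (φ ⁻¹' V) (f ∘ φ)

/-- An isomorphism of varieties: a bijection that is a morphism in both directions. -/
structure VarietyIso {k : ℕ} {ι κ : Type} (S : Set (ι → CompleteFlag k))
    (T : Set (κ → CompleteFlag k)) extends S ≃ T where
  isMorphism_toFun : IsMorphism toFun
  isMorphism_invFun : IsMorphism invFun

/-- The product variety `S × T`, inside `Fl_k^ι × Fl_k^κ = Fl_k^(ι ⊕ κ)`. -/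
def prodVariety {k : ℕ} {ι κ : Type} (S : Set (ι → CompleteFlag k))
    (T : Set (κ → CompleteFlag k)) : Set (ι ⊕ κ → CompleteFlag k) :=
  {F | F ∘ Sum.inl ∈ S ∧ F ∘ Sum.inr ∈ T}

/-- `U` is a principal open subset of `S`: the nonvanishing locus of a regular function on `S`. -/
def IsPrincipalOpen {k : ℕ} {ι : Type} (S U : Set (ι → CompleteFlag k)) : Prop :=
  U ⊆ S ∧ ∃ f : S → ℂ, IsRegularOn Set.univ f ∧ ∀ F : S, F.val ∈ U ↔ f F ≠ 0

/-! ### Braid varieties -/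

/-- The braid variety `X(β)` of the braid word `β = σ_{i_1} ⋯ σ_{i_r}`: tuples `(F^0, …, F^r)` of
flags with `F^0` standard, `F^r` antistandard, and `F^{j-1}`, `F^j` in position `s_{i_j}`. -/
def braidVariety {k : ℕ} (β : List (Fin (k - 1))) : Set (Fin (β.length + 1) → CompleteFlag k) :=
  {F | F 0 = stdFlag k ∧ F (Fin.last β.length) = antFlag k ∧
    ∀ j : Fin β.length, RelPos (F j.castSucc) (simpleTransposition (β.get j)) (F j.succ)}

/-- The set `U_{r₁,w}` of points of `X(β)` whose `r₁`-th flag is transverse to `F(w₀ w)`. -/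
def splicingLocus {k : ℕ} (β : List (Fin (k - 1))) (r₁ : Fin (β.length + 1))
    (w : Equiv.Perm (Fin k)) : Set (Fin (β.length + 1) → CompleteFlag k) :=
  {F | F ∈ braidVariety β ∧ Transverse (F r₁) (coordFlag (longest k * w))}

/-- `M` is lower triangular with ones on the diagonal. -/
def IsUnitLower {k : ℕ} (M : Matrix.GeneralLinearGroup (Fin k) ℂ) : Prop :=
  (∀ i j, i < j → M.val i j = 0) ∧ ∀ i, M.val i i = 1

/-- The pair `G` is obtained from the point `F` of `X(β)` by splicing. Here `a` and `b` are words of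
`w` and `w⁻¹ w₀`. The coordinate flags along `a` lead from the antistandard flag `F(w₀)` to
`F(w₀ w)`, those along `b` lead from `F(w₀ w)` to the standard flag. Let `F^{r₁} = F(w₀ w w₀ L)`
with `L` unit lower triangular, and put `g₂ = (w₀ w w₀ L)⁻¹`, `g₁ = w₀ g₂`. Then
* the first component of `G` is
  `g₁ (F(w₀ w), …, F^std = F^0, F^1, …, F^{r₁})`, with the coordinate flags along `b`;
* the second component of `G` is
  `g₂ (F^{r₁}, …, F^r = F(w₀), …, F(w₀ w))`, with the coordinate flags along `a`. -/
def IsSplicingOf {k : ℕ} (β : List (Fin (k - 1))) (r₁ : Fin (β.length + 1))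
    (w : Equiv.Perm (Fin k)) (a b : List (Fin (k - 1)))
    (F : Fin (β.length + 1) → CompleteFlag k)
    (G : Fin ((b ++ β.take r₁).length + 1) ⊕ Fin ((β.drop r₁ ++ a).length + 1) →
      CompleteFlag k) : Prop :=
  ∃ L g₁ g₂ : Matrix.GeneralLinearGroup (Fin k) ℂ, IsUnitLower L ∧
    F r₁ = flagOf (permGL (longest k * w * longest k) * L) ∧
    g₂ = (permGL (longest k * w * longest k) * L)⁻¹ ∧
    g₁ = permGL (longest k) * g₂ ∧
    (∀ j : Fin ((b ++ β.take r₁).length + 1), (j : ℕ) ≤ b.length →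
      G (Sum.inl j) = g₁ • coordFlag (longest k * w * wordPerm (b.take j))) ∧
    (∀ (j : Fin ((b ++ β.take r₁).length + 1)) (i : Fin (β.length + 1)),
      (j : ℕ) = b.length + i → G (Sum.inl j) = g₁ • F i) ∧
    (∀ (j : Fin ((β.drop r₁ ++ a).length + 1)) (i : Fin (β.length + 1)),
      (i : ℕ) = r₁ + j → G (Sum.inr j) = g₂ • F i) ∧
    (∀ (j : Fin ((β.drop r₁ ++ a).length + 1)) (n : ℕ), (r₁ + j : ℕ) = β.length + n →
      G (Sum.inr j) = g₂ • coordFlag (longest k * wordPerm (a.take n)))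

end BraidSplicing

open BraidSplicing

/-! The flags transverse to `F(w₀w)` form the big cell `w₀ww₀·L·F^std` with `L` lower unitriangular,
and `L` is unique. In terms of a matrix `M` representing the flag, membership says that the leading
minors of `(w₀ww₀)⁻¹M` do not vanish, and the entries of `L` are ratios of minors
(`transverse_iff_exists_unitLower`, `unitLower_apply`). Minors depend on the representative, so (1)
uses a matrix whose entries are regular functions on `X(β)`, built one crossing at a time
(`exists_regular_lift`). For (3), the rows of an invertible matrix can be permuted so that all
leading minors are nonzero.

For (2), put `N = L⁻¹`, so `g₂ = N·w₀w⁻¹w₀`. After translation by `g₁`, the coordinate path along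
`b` becomes the `w₀Nw₀`-translate of the coordinate path starting at `F^std`. After translation by
`g₂`, the path along `a` becomes the `N`-translate of one ending at `F^ant`. Since `w₀Nw₀` fixes
`F^std` and `N` fixes `F^ant`, the splice lies in the product of braid varieties.

Conversely, a path along a reduced word from `F^std` is a unipotent translate of the coordinate path
(`IsAscending.exists_unitUpper`) and is determined by its end (`IsAscending.smul_coordFlag_eq`). A
point of the product thus supplies two lower unitriangular matrices, one for `b` and one for the
reverse of `a`. They matter only through their action on the opposite coordinate flags `F(w₀w⁻¹w₀)`
and `F(w₀w⁻¹)`, where a single `N` replaces both (`exists_common_unitLower`), uniquely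
(`IsUnitLower.eq_of_smul_eq`). Undoing `g₁` and `g₂` recovers the original tuple.

Both maps lift to matrices with locally rational entries, because `N` is expressed by minors: of
`F^{r₁}` in one direction, and of the two junction flags in the other
(`isLocallyRationalGL_of_opposite`). Such a lift makes a map a morphism (`isMorphism_of_lift`). -/

namespace BraidSplicing

open Matrix

/-! ### Triangular and permutation matrices -/

section Triangular

variable {k : ℕ} {α : Type*} [LinearOrder α]

theorem blockTriangular_inv {M : GeneralLinearGroup (Fin k) ℂ} {b : Fin k → α}
    (hM : M.val.BlockTriangular b) : (M⁻¹).val.BlockTriangular b := by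
  have : Invertible M.val := Units.invertible M
  rw [coe_units_inv]
  exact blockTriangular_inv_of_blockTriangular hM

theorem blockTriangular_mul {M N : GeneralLinearGroup (Fin k) ℂ} {b : Fin k → α}
    (hM : M.val.BlockTriangular b) (hN : N.val.BlockTriangular b) :
    (M * N).val.BlockTriangular b :=
  hM.mul hN

/-- The permutation matrices form a representation. -/
theorem permGL_mul (u v : Equiv.Perm (Fin k)) : permGL (u * v) = permGL u * permGL v := by
  ext i j
  simp [permGL, Matrix.mul_apply]
  congr

theorem permGL_one : permGL (1 : Equiv.Perm (Fin k)) = 1 := by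
  ext i j
  simp [permGL, Matrix.one_apply]
  congr

theorem permGL_inv (u : Equiv.Perm (Fin k)) : permGL u⁻¹ = (permGL u)⁻¹ := by
  rw [eq_inv_iff_mul_eq_one, ← permGL_mul, inv_mul_cancel, permGL_one]

theorem permGL_mul_apply (u : Equiv.Perm (Fin k)) (M : GeneralLinearGroup (Fin k) ℂ)
    (i j : Fin k) : (permGL u * M).val i j = M.val (u⁻¹ i) j := by
  have (l : Fin k) : (i = u l) ↔ (u⁻¹ i = l) := by
    rw [Equiv.Perm.inv_eq_iff_eq, eq_comm, eq_comm]
  simp [permGL, Matrix.mul_apply, this]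

theorem mul_permGL_apply (u : Equiv.Perm (Fin k)) (M : GeneralLinearGroup (Fin k) ℂ)
    (i j : Fin k) : (M * permGL u).val i j = M.val i (u j) := by
  simp [permGL, Matrix.mul_apply]

theorem permGL_conj_apply (u : Equiv.Perm (Fin k)) (M : GeneralLinearGroup (Fin k) ℂ)
    (i j : Fin k) : (permGL u * M * permGL u⁻¹).val i j = M.val (u⁻¹ i) (u⁻¹ j) := by
  rw [mul_permGL_apply, permGL_mul_apply]

theorem longest_mul_longest : longest k * longest k = 1 := by
  ext i
  simp [longest]

theorem longest_inv : (longest k)⁻¹ = longest k :=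
  inv_eq_of_mul_eq_one_left longest_mul_longest

theorem longest_apply (i : Fin k) : longest k i = i.rev := rfl

theorem longest_conj_apply (M : GeneralLinearGroup (Fin k) ℂ) (i j : Fin k) :
    (permGL (longest k) * M * permGL (longest k)).val i j = M.val i.rev j.rev := by
  rw [mul_permGL_apply, permGL_mul_apply, longest_inv]
  rfl

theorem isUpperTriangular_longest_conj {M : GeneralLinearGroup (Fin k) ℂ} :
    (permGL (longest k) * M * permGL (longest k)).val.IsUpperTriangular ↔
      M.val.IsLowerTriangular := by
  refine ⟨fun h i j hij => ?_, fun h i j hij => ?_⟩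
  · have := @h i.rev j.rev (by simpa using hij)
    rwa [longest_conj_apply, Fin.rev_rev, Fin.rev_rev] at this
  · rw [longest_conj_apply]
    exact h (by simpa using hij)

theorem isLowerTriangular_longest_conj {M : GeneralLinearGroup (Fin k) ℂ} :
    (permGL (longest k) * M * permGL (longest k)).val.IsLowerTriangular ↔
      M.val.IsUpperTriangular := by
  refine ⟨fun h i j hij => ?_, fun h i j hij => ?_⟩
  · have := @h i.rev j.rev (by simpa using hij)
    rwa [longest_conj_apply, Fin.rev_rev, Fin.rev_rev] at this
  · rw [longest_conj_apply]
    exact h (by simpa using hij)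

theorem IsUnitLower.isLowerTriangular {M : GeneralLinearGroup (Fin k) ℂ} (h : IsUnitLower M) :
    M.val.IsLowerTriangular := fun i j hij => h.1 i j hij

theorem isLowerTriangular_mul_diag {M N : Matrix (Fin k) (Fin k) ℂ} (hM : M.IsLowerTriangular)
    (hN : N.IsLowerTriangular) (i : Fin k) : (M * N) i i = M i i * N i i := by
  rw [Matrix.mul_apply]
  refine Finset.sum_eq_single i (fun j _ hji => ?_) (by simp)
  rcases lt_or_gt_of_ne hji with h | h
  · rw [hN (i := j) (j := i) h, mul_zero]
  · rw [hM (i := i) (j := j) h, zero_mul]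

theorem IsUnitLower.mul {M N : GeneralLinearGroup (Fin k) ℂ} (hM : IsUnitLower M)
    (hN : IsUnitLower N) : IsUnitLower (M * N) :=
  ⟨fun _ _ hij => (hM.isLowerTriangular.mul hN.isLowerTriangular) hij, fun i => by
    rw [Units.val_mul, isLowerTriangular_mul_diag hM.isLowerTriangular hN.isLowerTriangular,
      hM.2, hN.2, one_mul]⟩

theorem IsUnitLower.one : IsUnitLower (1 : GeneralLinearGroup (Fin k) ℂ) :=
  ⟨fun _ _ hij => Matrix.one_apply_ne hij.ne, fun _ => Matrix.one_apply_eq _⟩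

theorem IsUnitLower.inv {M : GeneralLinearGroup (Fin k) ℂ} (hM : IsUnitLower M) :
    IsUnitLower M⁻¹ := by
  have h := blockTriangular_inv hM.isLowerTriangular
  refine ⟨fun _ _ hij => h hij, fun i => ?_⟩
  have := isLowerTriangular_mul_diag h hM.isLowerTriangular i
  rw [← Units.val_mul, inv_mul_cancel, hM.2, mul_one] at this
  rw [← this, Units.val_one, Matrix.one_apply_eq]

end Triangular

/-! ### Flags and relative position -/

section Flags

variable {k : ℕ}

theorem smul_flagOf (g M : GeneralLinearGroup (Fin k) ℂ) : g • flagOf M = flagOf (g * M) := by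
  ext1
  funext i
  change (Submodule.span ℂ _).map (Matrix.mulVecLin g.val) = Submodule.span ℂ _
  rw [Submodule.map_span, Set.image_image]
  congr 2

theorem stdFlag_eq : stdFlag k = flagOf 1 := by
  rw [stdFlag, coordFlag, permGL_one]

theorem flagOf_eq_smul (M : GeneralLinearGroup (Fin k) ℂ) : flagOf M = M • stdFlag k := by
  rw [stdFlag_eq, smul_flagOf, mul_one]

theorem mem_stdFlag {i : Fin (k + 1)} {v : Fin k → ℂ} :
    v ∈ (stdFlag k).sub i ↔ ∀ a : Fin k, (i : ℕ) ≤ a → v a = 0 := by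
  rw [stdFlag_eq]
  change v ∈ Submodule.span ℂ ((fun j a => (1 : Matrix (Fin k) (Fin k) ℂ) a j) '' _) ↔ _
  constructor
  · intro hv a ha
    induction hv using Submodule.span_induction with
    | mem x hx =>
      obtain ⟨j, hj, rfl⟩ := hx
      exact Matrix.one_apply_ne (fun h => by subst h; exact absurd hj (not_lt.mpr ha))
    | zero => rfl
    | add x y _ _ hx hy => rw [Pi.add_apply, hx, hy, add_zero]
    | smul c x _ hx => rw [Pi.smul_apply, hx, smul_zero]
  · intro hv
    have : v = ∑ j : Fin k, v j • (fun a => (1 : Matrix (Fin k) (Fin k) ℂ) a j) := by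
      ext a
      simp [Matrix.one_apply]
    rw [this]
    refine Submodule.sum_mem _ fun j _ => ?_
    by_cases hj : (j : ℕ) < i
    · exact Submodule.smul_mem _ _ (Submodule.subset_span ⟨j, hj, rfl⟩)
    · rw [hv j (not_lt.mp hj), zero_smul]
      exact Submodule.zero_mem _

theorem flagOf_eq_stdFlag_iff {M : GeneralLinearGroup (Fin k) ℂ} :
    flagOf M = stdFlag k ↔ M.val.IsUpperTriangular := by
  constructor
  · intro h i j hij
    have hmem : (fun a => M.val a j) ∈ (flagOf M).sub j.succ :=
      Submodule.subset_span ⟨j, by simp, rfl⟩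
    rw [h, mem_stdFlag] at hmem
    exact hmem i (by simpa using hij)
  · intro h
    ext1
    funext i
    refine Submodule.eq_of_le_of_finrank_eq ?_ ?_
    · refine Submodule.span_le.mpr ?_
      rintro _ ⟨j, hj, rfl⟩
      refine mem_stdFlag.mpr fun a ha => h ?_
      exact Fin.lt_def.mpr (lt_of_lt_of_le hj ha)
    · rw [CompleteFlag.finrank_sub, CompleteFlag.finrank_sub]

theorem flagOf_eq_iff {M N : GeneralLinearGroup (Fin k) ℂ} :
    flagOf M = flagOf N ↔ (N⁻¹ * M).val.IsUpperTriangular := by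
  rw [← flagOf_eq_stdFlag_iff, ← smul_flagOf, inv_smul_eq_iff, ← flagOf_eq_smul]

theorem flagOf_mul_upper {M U : GeneralLinearGroup (Fin k) ℂ} (hU : U.val.IsUpperTriangular) :
    flagOf (M * U) = flagOf M := by
  rw [flagOf_eq_iff, inv_mul_cancel_left]
  exact hU

theorem flagOf_eq_mul_upper {M N : GeneralLinearGroup (Fin k) ℂ} (h : flagOf M = flagOf N) :
    ∃ U : GeneralLinearGroup (Fin k) ℂ, U.val.IsUpperTriangular ∧ M = N * U :=
  ⟨N⁻¹ * M, flagOf_eq_iff.mp h, by rw [mul_inv_cancel_left]⟩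

/-- The stabiliser of `F(u)` is the conjugate of the upper triangular group by `u`. This turns
equalities of translated coordinate flags into vanishing of matrix entries. -/
theorem smul_coordFlag_eq_self_iff {g : GeneralLinearGroup (Fin k) ℂ} {u : Equiv.Perm (Fin k)} :
    g • coordFlag u = coordFlag u ↔ ∀ i j, u⁻¹ j < u⁻¹ i → g.val i j = 0 := by
  rw [coordFlag, smul_flagOf, flagOf_eq_iff]
  have key (i j : Fin k) : ((permGL u)⁻¹ * (g * permGL u)).val i j = g.val (u i) (u j) := by
    rw [← permGL_inv, permGL_mul_apply, mul_permGL_apply, inv_inv]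
  constructor
  · intro h i j hij
    have := @h (u⁻¹ i) (u⁻¹ j) hij
    simpa [key] using this
  · intro h i j hij
    rw [key]
    exact h _ _ (by simpa using hij)

theorem smul_antFlag_eq_self_iff {g : GeneralLinearGroup (Fin k) ℂ} :
    g • antFlag k = antFlag k ↔ g.val.IsLowerTriangular := by
  rw [antFlag, smul_coordFlag_eq_self_iff]
  simp only [longest_inv, longest_apply, Fin.rev_lt_rev]
  rfl

theorem permGL_smul_coordFlag (u v : Equiv.Perm (Fin k)) :
    permGL u • coordFlag v = coordFlag (u * v) := by
  rw [coordFlag, coordFlag, smul_flagOf, permGL_mul]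

theorem RelPos.smul {F F' : CompleteFlag k} {w : Equiv.Perm (Fin k)} (h : RelPos F w F')
    (g : GeneralLinearGroup (Fin k) ℂ) : RelPos (g • F) w (g • F') := by
  obtain ⟨x, h1, h2⟩ := h
  exact ⟨x * g⁻¹, by rw [mul_smul, inv_smul_smul, h1], by rw [mul_smul, inv_smul_smul, h2]⟩

theorem RelPos.symm {F F' : CompleteFlag k} {w : Equiv.Perm (Fin k)} (h : RelPos F w F') :
    RelPos F' w⁻¹ F := by
  obtain ⟨x, h1, h2⟩ := h
  refine ⟨permGL w⁻¹ * x, ?_, ?_⟩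
  · rw [mul_smul, h2, permGL_smul_coordFlag, inv_mul_cancel, stdFlag]
  · rw [mul_smul, h1, stdFlag, permGL_smul_coordFlag, mul_one]

theorem relPos_coordFlag (u v : Equiv.Perm (Fin k)) :
    RelPos (coordFlag u) v (coordFlag (u * v)) :=
  ⟨permGL u⁻¹, by rw [permGL_smul_coordFlag, inv_mul_cancel, stdFlag],
    by rw [permGL_smul_coordFlag, inv_mul_cancel_left]⟩

/-- If `x` normalises the pair of flags, then `xM` fixes the standard flag and is therefore upper
triangular; its inverse is `U`. -/
theorem RelPos.exists_upper {M : GeneralLinearGroup (Fin k) ℂ} {F' : CompleteFlag k}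
    {w : Equiv.Perm (Fin k)} (h : RelPos (flagOf M) w F') :
    ∃ U : GeneralLinearGroup (Fin k) ℂ, U.val.IsUpperTriangular ∧
      F' = flagOf (M * U * permGL w) := by
  obtain ⟨x, h1, h2⟩ := h
  refine ⟨(x * M)⁻¹, blockTriangular_inv ?_, ?_⟩
  · rwa [smul_flagOf, flagOf_eq_stdFlag_iff] at h1
  · rw [_root_.mul_inv_rev, mul_inv_cancel_left, ← smul_flagOf, eq_inv_smul_iff, h2, coordFlag]

/-- The root subgroup: the matrix with ones on the diagonal and `z` at the entry `(p, q)`. -/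
def rootGL (p q : Fin k) (hpq : p ≠ q) (z : ℂ) : GeneralLinearGroup (Fin k) ℂ where
  val := transvection p q z
  inv := transvection p q (-z)
  val_inv := by rw [transvection_mul_transvection_same _ _ hpq, add_neg_cancel, transvection_zero]
  inv_val := by rw [transvection_mul_transvection_same _ _ hpq, neg_add_cancel, transvection_zero]

theorem rootGL_apply (p q : Fin k) (hpq : p ≠ q) (z : ℂ) (i j : Fin k) :
    (rootGL p q hpq z).val i j = (if i = j then 1 else 0) + if p = i ∧ q = j then z else 0 := by
  simp [rootGL, transvection, Matrix.one_apply, Matrix.single_apply]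

theorem rootGL_inv_apply (p q : Fin k) (hpq : p ≠ q) (z : ℂ) :
    (rootGL p q hpq z)⁻¹ = rootGL p q hpq (-z) := by
  ext i j
  rfl

theorem rootGL_isUpperTriangular {p q : Fin k} (hpq : p < q) (z : ℂ) :
    (rootGL p q hpq.ne z).val.IsUpperTriangular :=
  blockTriangular_transvection hpq.le z

theorem permGL_mul_rootGL (u : Equiv.Perm (Fin k)) {p q : Fin k} (hpq : p ≠ q) (z : ℂ) :
    permGL u * rootGL p q hpq z = rootGL (u p) (u q) (u.injective.ne hpq) z * permGL u := by
  ext i j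
  rw [permGL_mul_apply, mul_permGL_apply, rootGL_apply, rootGL_apply]
  simp only [Equiv.Perm.inv_eq_iff_eq, Equiv.Perm.eq_inv_iff_eq, EmbeddingLike.apply_eq_iff_eq]

/-- The position `i` of the strands exchanged by `σ_i`. -/
def lowerStrand (i : Fin (k - 1)) : Fin k := ⟨i, by omega⟩

/-- The position `i + 1` of the strands exchanged by `σ_i`. -/
def upperStrand (i : Fin (k - 1)) : Fin k := ⟨i + 1, by omega⟩

theorem lowerStrand_lt_upperStrand (i : Fin (k - 1)) : lowerStrand i < upperStrand i :=
  Fin.lt_def.mpr (Nat.lt_succ_self _)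

theorem simpleTransposition_eq (i : Fin (k - 1)) :
    simpleTransposition i = Equiv.swap (lowerStrand i) (upperStrand i) := rfl

theorem simpleTransposition_inv (i : Fin (k - 1)) :
    (simpleTransposition i)⁻¹ = simpleTransposition i := Equiv.swap_inv _ _

/-- A simple transposition has exactly one inversion. The combinatorics of reduced words below rests
on this. -/
theorem simpleTransposition_lt (i : Fin (k - 1)) {p q : Fin k} (hpq : p < q)
    (h : ¬(p = lowerStrand i ∧ q = upperStrand i)) :
    simpleTransposition i p < simpleTransposition i q := by
  rw [simpleTransposition_eq, Equiv.swap_apply_def, Equiv.swap_apply_def]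
  simp only [lowerStrand, upperStrand, Fin.ext_iff, Fin.lt_def] at *
  split_ifs <;> (try simp only) <;> omega

/-- Crossing `σ_i` with parameter `z`: the matrix whose flag is a point of the line of flags in
position `s_i` to the standard flag. -/
def crossing (i : Fin (k - 1)) (z : ℂ) : GeneralLinearGroup (Fin k) ℂ :=
  rootGL (lowerStrand i) (upperStrand i) (lowerStrand_lt_upperStrand i).ne z *
    permGL (simpleTransposition i)

/-- Only one parameter of the upper triangular matrix is visible: once the root entry is split off,
the remaining factor stays upper triangular under conjugation by `s_i` and does not move the flag.
-/
theorem RelPos.exists_crossing {M : GeneralLinearGroup (Fin k) ℂ} {F' : CompleteFlag k}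
    {i : Fin (k - 1)} (h : RelPos (flagOf M) (simpleTransposition i) F') :
    ∃ z, F' = flagOf (M * crossing i z) := by
  obtain ⟨U, hU, rfl⟩ := h.exists_upper
  set p := lowerStrand i with hp
  set q := upperStrand i with hq
  have hpq : p < q := lowerStrand_lt_upperStrand i
  have hUq : U.val q q ≠ 0 := by
    have hdet : U.val.det ≠ 0 := ((Matrix.isUnit_iff_isUnit_det _).mp U.isUnit).ne_zero
    rw [det_of_isUpperTriangular hU] at hdet
    exact (Finset.prod_ne_zero_iff.mp hdet) q (Finset.mem_univ _)
  -- Subtracting this multiple of row `q` from row `p` clears the entry `(p, q)` of `U`.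
  refine ⟨U.val p q / U.val q q, ?_⟩
  rw [flagOf_eq_iff]
  set z := U.val p q / U.val q q with hz
  have hV : ((rootGL p q hpq.ne z)⁻¹ * U).val.IsUpperTriangular :=
    blockTriangular_mul (blockTriangular_inv (rootGL_isUpperTriangular hpq z)) hU
  have hV0 : ((rootGL p q hpq.ne z)⁻¹ * U).val p q = 0 := by
    rw [rootGL_inv_apply, Units.val_mul, Matrix.mul_apply]
    simp only [rootGL_apply, add_mul, Finset.sum_add_distrib]
    simp [hz, hUq]
  have e : (M * crossing i z)⁻¹ * (M * U * permGL (simpleTransposition i)) =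
      permGL (simpleTransposition i) * ((rootGL p q hpq.ne z)⁻¹ * U) *
        permGL (simpleTransposition i)⁻¹ := by
    rw [crossing, _root_.mul_inv_rev, _root_.mul_inv_rev, ← permGL_inv, simpleTransposition_inv]
    simp only [mul_assoc, inv_mul_cancel_left]
    rfl
  rw [e]
  intro a b hab
  rw [permGL_conj_apply, simpleTransposition_inv]
  by_cases h' : b = p ∧ a = q
  · rw [h'.1, h'.2, simpleTransposition_eq, Equiv.swap_apply_left, Equiv.swap_apply_right]
    exact hV0
  · exact hV (simpleTransposition_lt i hab h')

end Flags

/-! ### Minors and LU decomposition -/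

section Minors

variable {K : Type*} [Field K]

/-- The minor of `A` on the rows `0, …, j - 1, p` and the columns `0, …, j`. -/
def cornerMinor {k : ℕ} (A : Matrix (Fin k) (Fin k) K) (p j : Fin k) : K :=
  (A.submatrix (fun a : Fin (j + 1) => if (a : ℕ) < j then a.castLE j.isLt else p)
    (Fin.castLE j.isLt)).det

theorem cornerMinor_self {k : ℕ} (A : Matrix (Fin k) (Fin k) K) (j : Fin k) :
    cornerMinor A j j = (A.submatrix (Fin.castLE j.isLt) (Fin.castLE j.isLt)).det := by
  rw [cornerMinor]
  congr 2
  ext a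
  split_ifs with h
  · rfl
  · exact le_antisymm (not_lt.mp h) (Nat.lt_succ_iff.mp a.isLt)

/-- The first `j + 1` columns of `C * U` involve only the first `j + 1` columns of `C`. The factor
does not depend on `p`, so ratios of corner minors with the same `j` are invariants of the flag. -/
theorem cornerMinor_mul_upper {k : ℕ} (C : Matrix (Fin k) (Fin k) K) {U : Matrix (Fin k) (Fin k) K}
    (hU : U.IsUpperTriangular) (p j : Fin k) :
    cornerMinor (C * U) p j = cornerMinor C p j * cornerMinor U j j := by
  rw [cornerMinor_self, cornerMinor, cornerMinor, ← det_mul]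
  congr 1
  ext a b
  simp only [submatrix_apply, Matrix.mul_apply]
  symm
  refine Fintype.sum_of_injective (Fin.castLE j.isLt) (Fin.castLE_injective _) _ _ ?_ ?_
  · intro l hl
    rw [hU (i := l) (j := Fin.castLE j.isLt b), mul_zero]
    refine Fin.lt_def.mpr ?_
    by_contra hlt
    exact hl ⟨⟨l, lt_of_le_of_lt (not_lt.mp hlt) b.isLt⟩, rfl⟩
  · intro l
    rfl

theorem cornerMinor_upper {k : ℕ} {U : Matrix (Fin k) (Fin k) K} (hU : U.IsUpperTriangular)
    (j : Fin k) : cornerMinor U j j = ∏ a : Fin (j + 1), U (a.castLE j.isLt) (a.castLE j.isLt) := by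
  rw [cornerMinor_self, det_of_isUpperTriangular]
  · rfl
  · intro a b hab
    exact hU hab

theorem cornerMinor_upper_ne_zero {k : ℕ} {U : Matrix (Fin k) (Fin k) K}
    (hU : U.IsUpperTriangular) (hdet : U.det ≠ 0) (j : Fin k) : cornerMinor U j j ≠ 0 := by
  rw [det_of_isUpperTriangular hU, Finset.prod_ne_zero_iff] at hdet
  rw [cornerMinor_upper hU, Finset.prod_ne_zero_iff]
  exact fun a _ => hdet _ (Finset.mem_univ _)

/-- The submatrix is lower triangular with diagonal `1, …, 1, A p j`. Only the rows before `j` are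
constrained, so that crossings are covered as well as unitriangular matrices. -/
theorem cornerMinor_eq_entry {k : ℕ} {A : Matrix (Fin k) (Fin k) K} (p j : Fin k)
    (h0 : ∀ a b, a < j → a < b → b ≤ j → A a b = 0) (h1 : ∀ a, a < j → A a a = 1) :
    cornerMinor A p j = A p j := by
  rw [cornerMinor, det_of_isLowerTriangular, Fin.prod_univ_castSucc]
  · have : ∀ a : Fin j, A (a.castSucc.castLE j.isLt) (a.castSucc.castLE j.isLt) = 1 :=
      fun a => h1 _ a.isLt
    simp only [submatrix_apply, Fin.val_castSucc, Fin.is_lt, if_true, this, Finset.prod_const_one,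
      one_mul, Fin.val_last, lt_self_iff_false, if_false]
    rfl
  · intro a b hab
    have hab' : (a : ℕ) < b := hab
    have ha : (a : ℕ) < j := lt_of_lt_of_le hab' (Nat.lt_succ_iff.mp b.isLt)
    simp only [submatrix_apply, ha, if_true]
    exact h0 _ _ ha hab' (Nat.lt_succ_iff.mp b.isLt)

theorem cornerMinor_unitLower {k : ℕ} {L : Matrix (Fin k) (Fin k) K} (hL : L.IsLowerTriangular)
    (h1 : ∀ i, L i i = 1) (p j : Fin k) : cornerMinor L p j = L p j :=
  cornerMinor_eq_entry p j (fun _ _ _ hab _ => hL hab) fun a _ => h1 a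

theorem cornerMinor_last {n : ℕ} (A : Matrix (Fin (n + 1)) (Fin (n + 1)) K) :
    cornerMinor A (Fin.last n) (Fin.last n) = A.det := by
  rw [cornerMinor_self]
  rfl

theorem cornerMinor_castSucc {n : ℕ} (A : Matrix (Fin (n + 1)) (Fin (n + 1)) K) (j : Fin n) :
    cornerMinor A j.castSucc j.castSucc =
      cornerMinor (A.submatrix Fin.castSucc Fin.castSucc) j j := by
  rw [cornerMinor_self, cornerMinor_self]
  rfl

theorem det_ne_zero_of_cornerMinor {k : ℕ} {A : Matrix (Fin k) (Fin k) K}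
    (h : ∀ j, cornerMinor A j j ≠ 0) : A.det ≠ 0 := by
  cases k with
  | zero => simp
  | succ n => exact cornerMinor_last A ▸ h (Fin.last n)

/-- An invertible matrix has, up to a permutation of its rows, nonzero leading minors. -/
theorem exists_perm_cornerMinor_ne_zero {k : ℕ} {A : Matrix (Fin k) (Fin k) K}
    (hA : A.det ≠ 0) :
    ∃ w : Equiv.Perm (Fin k), ∀ j, cornerMinor (A.submatrix w id) j j ≠ 0 := by
  induction k with
  | zero => exact ⟨1, fun j => j.elim0⟩
  | succ n ih =>
    -- Laplace expansion along the last column gives a row `p` whose complementary minor is nonzero;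
    -- this row is moved to the last place.
    obtain ⟨p, hp⟩ : ∃ p : Fin (n + 1), (A.submatrix p.succAbove (Fin.last n).succAbove).det ≠ 0 := by
      by_contra! h
      refine hA ?_
      rw [det_succ_column A (Fin.last n)]
      exact Finset.sum_eq_zero fun p _ => by rw [h p, mul_zero]
    obtain ⟨w, hw⟩ := ih hp
    let v : Equiv.Perm (Fin (n + 1)) :=
      ((finSuccEquiv' (Fin.last n)).trans (Equiv.optionCongr w)).trans (finSuccEquiv' p).symm
    have hv (j : Fin n) : v j.castSucc = p.succAbove (w j) := by
      have h : finSuccEquiv' (Fin.last n) j.castSucc = some j := by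
        rw [← Fin.succAbove_last_apply, finSuccEquiv'_succAbove]
      simp [v, h]
    refine ⟨v, fun j => ?_⟩
    refine Fin.lastCases ?_ (fun j => ?_) j
    · rw [cornerMinor_last, det_permute]
      refine mul_ne_zero ?_ hA
      rcases Int.units_eq_one_or (Equiv.Perm.sign v) with h | h <;> simp [h]
    · rw [cornerMinor_castSucc]
      convert hw j using 2
      ext a b
      simp [hv]

/-- LU decomposition: a matrix with nonzero leading minors is a product of a lower unitriangular
and an upper triangular matrix; the lower factor inherits block triangularity for any order. -/
theorem exists_lu {k : ℕ} {α : Type*} [LinearOrder α] {A : Matrix (Fin k) (Fin k) K}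
    (h : ∀ j, cornerMinor A j j ≠ 0) {σ : Fin k → α} (hσ : A.BlockTriangular σ) :
    ∃ L U : Matrix (Fin k) (Fin k) K, L.IsLowerTriangular ∧ (∀ i, L i i = 1) ∧
      L.BlockTriangular σ ∧ U.IsUpperTriangular ∧ A = L * U := by
  induction k with
  | zero => exact ⟨1, 1, fun i => i.elim0, fun i => i.elim0, fun i => i.elim0,
      fun i => i.elim0, by ext i; exact i.elim0⟩
  | succ n ih =>
    set A' := A.submatrix Fin.castSucc Fin.castSucc with hA'
    have h' : ∀ j, cornerMinor A' j j ≠ 0 := fun j => cornerMinor_castSucc A j ▸ h j.castSucc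
    have hσ' : A'.BlockTriangular (σ ∘ Fin.castSucc) := hσ.submatrix
    obtain ⟨L', U', hL, hL1, hLσ, hU, hLU⟩ := ih h' hσ'
    have hdet := (det_ne_zero_of_cornerMinor h').isUnit
    have hLdet : IsUnit L'.det := by
      rw [det_of_isLowerTriangular _ hL]
      simp [hL1]
    have hinv : A'⁻¹.BlockTriangular (σ ∘ Fin.castSucc) := by
      have := invertibleOfIsUnitDet A' hdet
      exact blockTriangular_inv_of_blockTriangular hσ'
    -- This is the last row of `A` times `U'⁻¹`. Written with `A'⁻¹ * L'`, it is a product of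
    -- factors known to be triangular for `σ`, which is not known of `U'`.
    set x : Fin n → K := (fun j => A (Fin.last n) (Fin.castSucc j)) ᵥ* (A'⁻¹ * L') with hx
    set y : Fin n → K := L'⁻¹ *ᵥ (fun i => A (Fin.castSucc i) (Fin.last n)) with hy
    have hxU : x ᵥ* U' = fun j => A (Fin.last n) (Fin.castSucc j) := by
      rw [hx, vecMul_vecMul, Matrix.mul_assoc, ← hLU, nonsing_inv_mul _ hdet, vecMul_one]
    have hLy : L' *ᵥ y = fun i => A (Fin.castSucc i) (Fin.last n) := by
      rw [hy, mulVec_mulVec, mul_nonsing_inv _ hLdet, one_mulVec]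
    let L : Matrix (Fin (n + 1)) (Fin (n + 1)) K :=
      Fin.snoc (α := fun _ => Fin (n + 1) → K)
        (fun i => Fin.snoc (α := fun _ => K) (L' i) 0) (Fin.snoc (α := fun _ => K) x 1)
    let U : Matrix (Fin (n + 1)) (Fin (n + 1)) K :=
      Fin.snoc (α := fun _ => Fin (n + 1) → K)
        (fun i => Fin.snoc (α := fun _ => K) (U' i) (y i))
        -- The last diagonal entry is the Schur complement.
        (Fin.snoc (α := fun _ => K) 0 (A (Fin.last n) (Fin.last n) - x ⬝ᵥ y))
    refine ⟨L, U, fun i j hij => ?_, fun i => ?_, fun i j hij => ?_, fun i j hij => ?_, ?_⟩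
    · induction i using Fin.lastCases with
      | last => exact absurd hij (not_lt.mpr (Fin.le_last _))
      | cast i =>
        induction j using Fin.lastCases with
        | last => simp [L]
        | cast j => simpa [L] using hL (i := i) (j := j) hij
    · induction i using Fin.lastCases with
      | last => simp [L]
      | cast i => simp [L, hL1]
    · induction i using Fin.lastCases with
      | last =>
        induction j using Fin.lastCases with
        | last => exact absurd hij (lt_irrefl _)
        | cast j =>
          simp only [L, Fin.snoc_last, Fin.snoc_castSucc]
          rw [hx, vecMul, dotProduct]
          refine Finset.sum_eq_zero fun l _ => ?_
          rcases lt_or_ge (σ l.castSucc) (σ (Fin.last n)) with hl | hl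
          · rw [hσ hl, zero_mul]
          · rw [(hinv.mul hLσ) (i := l) (j := j) (lt_of_lt_of_le hij hl), mul_zero]
      | cast i =>
        induction j using Fin.lastCases with
        | last => simp [L]
        | cast j => simpa [L] using hLσ (i := i) (j := j) hij
    · induction j using Fin.lastCases with
      | last => exact absurd hij (not_lt.mpr (Fin.le_last _))
      | cast j =>
        induction i using Fin.lastCases with
        | last => simp [U]
        | cast i => simpa [U] using hU (i := i) (j := j) hij
    · ext i j
      rw [Matrix.mul_apply, Fin.sum_univ_castSucc]
      induction i using Fin.lastCases with
      | last =>
        induction j using Fin.lastCases with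
        | last => simp [L, U, dotProduct]
        | cast j => simpa [L, U, vecMul, dotProduct] using (congrFun hxU j).symm
      | cast i =>
        induction j using Fin.lastCases with
        | last => simpa [L, U, mulVec, dotProduct] using (congrFun hLy i).symm
        | cast j => simpa [L, U, A', Matrix.mul_apply] using congrFun₂ hLU i j

end Minors

/-! ### LU factors of invertible complex matrices -/

section GeneralLinear

variable {k : ℕ}

theorem det_ne_zero (M : GeneralLinearGroup (Fin k) ℂ) : M.val.det ≠ 0 :=
  ((Matrix.isUnit_iff_isUnit_det _).mp M.isUnit).ne_zero

theorem exists_lu_of_cornerMinor {α : Type*} [LinearOrder α] {A : GeneralLinearGroup (Fin k) ℂ}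
    (h : ∀ j, cornerMinor A.val j j ≠ 0) {σ : Fin k → α} (hσ : A.val.BlockTriangular σ) :
    ∃ L U : GeneralLinearGroup (Fin k) ℂ, IsUnitLower L ∧ L.val.BlockTriangular σ ∧
      U.val.IsUpperTriangular ∧ A = L * U := by
  obtain ⟨L, U, hL, hL1, hLσ, hU, hLU⟩ := exists_lu h hσ
  have hdet := det_ne_zero A
  rw [hLU, det_mul] at hdet
  refine ⟨GeneralLinearGroup.mkOfDetNeZero L (left_ne_zero_of_mul hdet),
    GeneralLinearGroup.mkOfDetNeZero U (right_ne_zero_of_mul hdet), ⟨fun i j hij => hL hij, hL1⟩,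
    hLσ, hU, Units.ext hLU⟩

/-- The upper factor multiplies both minors by the same number, and the minors of `L` are its
entries. -/
theorem unitLower_apply_of_lu {L U : GeneralLinearGroup (Fin k) ℂ} (hL : IsUnitLower L)
    (hU : U.val.IsUpperTriangular) (i j : Fin k) :
    L.val i j = cornerMinor (L * U).val i j / cornerMinor (L * U).val j j := by
  have := cornerMinor_upper_ne_zero hU (det_ne_zero U) j
  rw [Units.val_mul, cornerMinor_mul_upper _ hU, cornerMinor_mul_upper _ hU,
    cornerMinor_unitLower hL.isLowerTriangular hL.2, cornerMinor_unitLower hL.isLowerTriangular hL.2,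
    hL.2, one_mul, mul_div_cancel_right₀ _ this]

theorem cornerMinor_ne_zero_of_lu {L U : GeneralLinearGroup (Fin k) ℂ} (hL : IsUnitLower L)
    (hU : U.val.IsUpperTriangular) (j : Fin k) : cornerMinor (L * U).val j j ≠ 0 := by
  rw [Units.val_mul, cornerMinor_mul_upper _ hU, cornerMinor_unitLower hL.isLowerTriangular hL.2,
    hL.2, one_mul]
  exact cornerMinor_upper_ne_zero hU (det_ne_zero U) j

end GeneralLinear

/-! ### Locally rational functions of tuples of matrices -/

section LocallyRational

variable {k : ℕ} {ι κ : Type}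

/-- On the set `P` of tuples of matrices, `f` is locally a quotient of polynomials in the entries. -/
def IsLocallyRational (P : Set (ι → GeneralLinearGroup (Fin k) ℂ))
    (f : (ι → GeneralLinearGroup (Fin k) ℂ) → ℂ) : Prop :=
  ∀ m ∈ P, ∃ g h, evalAt m h ≠ 0 ∧ ∀ n ∈ P, evalAt n h ≠ 0 → f n = evalAt n g / evalAt n h

variable {P : Set (ι → GeneralLinearGroup (Fin k) ℂ)}
  {f f' : (ι → GeneralLinearGroup (Fin k) ℂ) → ℂ}

theorem evalAt_mul (m : ι → GeneralLinearGroup (Fin k) ℂ)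
    (p q : MvPolynomial (ι × Fin k × Fin k) ℂ) : evalAt m (p * q) = evalAt m p * evalAt m q :=
  map_mul _ _ _

theorem evalAt_add (m : ι → GeneralLinearGroup (Fin k) ℂ)
    (p q : MvPolynomial (ι × Fin k × Fin k) ℂ) : evalAt m (p + q) = evalAt m p + evalAt m q :=
  map_add _ _ _

theorem evalAt_C (m : ι → GeneralLinearGroup (Fin k) ℂ) (c : ℂ) :
    evalAt m (MvPolynomial.C c) = c :=
  MvPolynomial.eval_C c

theorem evalAt_X (m : ι → GeneralLinearGroup (Fin k) ℂ) (c : ι × Fin k × Fin k) :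
    evalAt m (MvPolynomial.X c) = (m c.1).val c.2.1 c.2.2 :=
  MvPolynomial.eval_X c

namespace IsLocallyRational

theorem congr (hf : IsLocallyRational P f) (h : ∀ m ∈ P, f' m = f m) : IsLocallyRational P f' := by
  intro m hm
  obtain ⟨p, q, h0, h1⟩ := hf m hm
  exact ⟨p, q, h0, fun n hn hq => by rw [h n hn, h1 n hn hq]⟩

theorem of_polynomial (p : MvPolynomial (ι × Fin k × Fin k) ℂ) :
    IsLocallyRational P fun m => evalAt m p := fun m _ =>
  ⟨p, MvPolynomial.C 1, by rw [evalAt_C]; exact one_ne_zero, fun n _ _ => by rw [evalAt_C, div_one]⟩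

theorem const (c : ℂ) : IsLocallyRational P fun _ => c :=
  (of_polynomial (MvPolynomial.C c)).congr fun m _ => (evalAt_C m c).symm

theorem entry (i : ι) (a b : Fin k) : IsLocallyRational P fun m => (m i).val a b :=
  (of_polynomial (MvPolynomial.X (i, a, b))).congr fun m _ => (evalAt_X m (i, a, b)).symm

theorem add (hf : IsLocallyRational P f) (hf' : IsLocallyRational P f') :
    IsLocallyRational P fun m => f m + f' m := by
  intro m hm
  obtain ⟨p, q, h0, h1⟩ := hf m hm
  obtain ⟨p', q', h0', h1'⟩ := hf' m hm
  refine ⟨p * q' + q * p', q * q', by rw [evalAt_mul]; exact mul_ne_zero h0 h0', fun n hn hq => ?_⟩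
  simp only [evalAt_mul, evalAt_add] at hq ⊢
  have a := left_ne_zero_of_mul hq
  have b := right_ne_zero_of_mul hq
  rw [h1 n hn a, h1' n hn b, div_add_div _ _ a b]

theorem mul (hf : IsLocallyRational P f) (hf' : IsLocallyRational P f') :
    IsLocallyRational P fun m => f m * f' m := by
  intro m hm
  obtain ⟨p, q, h0, h1⟩ := hf m hm
  obtain ⟨p', q', h0', h1'⟩ := hf' m hm
  refine ⟨p * p', q * q', by rw [evalAt_mul]; exact mul_ne_zero h0 h0', fun n hn hq => ?_⟩
  simp only [evalAt_mul] at hq ⊢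
  rw [h1 n hn (left_ne_zero_of_mul hq), h1' n hn (right_ne_zero_of_mul hq), div_mul_div_comm]

theorem div (hf : IsLocallyRational P f) (hf' : IsLocallyRational P f') (h : ∀ m ∈ P, f' m ≠ 0) :
    IsLocallyRational P fun m => f m / f' m := by
  intro m hm
  obtain ⟨p, q, h0, h1⟩ := hf m hm
  obtain ⟨p', q', h0', h1'⟩ := hf' m hm
  have hp' : evalAt m p' ≠ 0 := by
    have := h m hm
    rw [h1' m hm h0'] at this
    exact (div_ne_zero_iff.mp this).1
  -- The extra factor `q'` keeps the new denominator nonzero only where the formula for `f'` is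
  -- valid.
  refine ⟨p * q' * q', q * p' * q', ?_, fun n hn hq => ?_⟩
  · simp only [evalAt_mul]
    exact mul_ne_zero (mul_ne_zero h0 hp') h0'
  · simp only [evalAt_mul] at hq ⊢
    have b := right_ne_zero_of_mul hq
    rw [h1 n hn (left_ne_zero_of_mul (left_ne_zero_of_mul hq)), h1' n hn b,
      div_div_div_eq, mul_div_mul_right _ _ b]

theorem sum {τ : Type*} (s : Finset τ) {F : τ → (ι → GeneralLinearGroup (Fin k) ℂ) → ℂ}
    (h : ∀ t ∈ s, IsLocallyRational P (F t)) : IsLocallyRational P fun m => ∑ t ∈ s, F t m := by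
  classical
  induction s using Finset.induction_on with
  | empty => exact const 0
  | insert t s ht ih =>
    simp only [Finset.sum_insert ht]
    exact (h t (Finset.mem_insert_self _ _)).add
      (ih fun t ht => h t (Finset.mem_insert_of_mem ht))

theorem prod {τ : Type*} (s : Finset τ) {F : τ → (ι → GeneralLinearGroup (Fin k) ℂ) → ℂ}
    (h : ∀ t ∈ s, IsLocallyRational P (F t)) : IsLocallyRational P fun m => ∏ t ∈ s, F t m := by
  classical
  induction s using Finset.induction_on with
  | empty => exact const 1
  | insert t s ht ih =>
    simp only [Finset.prod_insert ht]
    exact (h t (Finset.mem_insert_self _ _)).mul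
      (ih fun t ht => h t (Finset.mem_insert_of_mem ht))

theorem det {τ : Type*} [Fintype τ] [DecidableEq τ]
    {A : (ι → GeneralLinearGroup (Fin k) ℂ) → Matrix τ τ ℂ}
    (h : ∀ a b, IsLocallyRational P fun m => A m a b) :
    IsLocallyRational P fun m => (A m).det := by
  simp only [det_apply']
  exact sum _ fun σ _ => (const _).mul (prod _ fun i _ => h _ _)

/-- Locally rational functions of locally rational matrices are locally rational. -/
theorem comp {Q : Set (κ → GeneralLinearGroup (Fin k) ℂ)}
    {F : (κ → GeneralLinearGroup (Fin k) ℂ) → ℂ} (hF : IsLocallyRational Q F)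
    {A : (ι → GeneralLinearGroup (Fin k) ℂ) → κ → GeneralLinearGroup (Fin k) ℂ}
    (hA : ∀ c a b, IsLocallyRational P fun m => (A m c).val a b) (hQ : ∀ m ∈ P, A m ∈ Q) :
    IsLocallyRational P fun m => F (A m) := by
  have hpol (p : MvPolynomial (κ × Fin k × Fin k) ℂ) :
      IsLocallyRational P fun m => evalAt (A m) p := by
    induction p using MvPolynomial.induction_on with
    | C c => exact (const c).congr fun m _ => evalAt_C _ _
    | add p q hp hq => exact (hp.add hq).congr fun m _ => evalAt_add _ _ _
    | mul_X p c hp =>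
      exact (hp.mul (hA c.1 c.2.1 c.2.2)).congr fun m _ => by rw [evalAt_mul, evalAt_X]
  intro m hm
  obtain ⟨p, q, h0, h1⟩ := hF (A m) (hQ m hm)
  -- Division needs a denominator without zeros on the whole set, so `P` is shrunk for the moment.
  have hloc := IsLocallyRational.div (P := {n | n ∈ P ∧ evalAt (A n) q ≠ 0})
    (f := fun m => evalAt (A m) p) (f' := fun m => evalAt (A m) q)
    (fun n hn => by
      obtain ⟨g, h, a, b⟩ := hpol p n hn.1
      exact ⟨g, h, a, fun n' hn' => b n' hn'.1⟩)
    (fun n hn => by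
      obtain ⟨g, h, a, b⟩ := hpol q n hn.1
      exact ⟨g, h, a, fun n' hn' => b n' hn'.1⟩) fun n hn => hn.2
  obtain ⟨g, h, a, b⟩ := hloc m ⟨hm, h0⟩
  obtain ⟨g', h', a', b'⟩ := hpol q m hm
  beta_reduce at b b'
  have hg' : evalAt m g' ≠ 0 := by
    rw [b' m hm a'] at h0
    exact (div_ne_zero_iff.mp h0).1
  -- Where `h' * g'` is nonzero, so is `q` at `A n`; the new denominator thereby confines `n` to the
  -- shrunken set.
  refine ⟨g * (h' * g'), h * (h' * g'), ?_, fun n hn hne => ?_⟩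
  · simp only [evalAt_mul]
    exact mul_ne_zero a (mul_ne_zero a' hg')
  · simp only [evalAt_mul] at hne ⊢
    have c := right_ne_zero_of_mul hne
    have hq : evalAt (A n) q ≠ 0 := by
      rw [b' n hn (left_ne_zero_of_mul c)]
      exact div_ne_zero (right_ne_zero_of_mul c) (left_ne_zero_of_mul c)
    rw [mul_div_mul_right _ _ c, ← b n ⟨hn, hq⟩ (left_ne_zero_of_mul hne), h1 _ (hQ n hn) hq]

end IsLocallyRational

/-- A matrix-valued function is locally rational if its entries are. -/
def IsLocallyRationalGL (P : Set (ι → GeneralLinearGroup (Fin k) ℂ))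
    (A : (ι → GeneralLinearGroup (Fin k) ℂ) → GeneralLinearGroup (Fin k) ℂ) : Prop :=
  ∀ a b, IsLocallyRational P fun m => (A m).val a b

namespace IsLocallyRationalGL

variable {A B : (ι → GeneralLinearGroup (Fin k) ℂ) → GeneralLinearGroup (Fin k) ℂ}

theorem congr (hA : IsLocallyRationalGL P A) (h : ∀ m ∈ P, B m = A m) :
    IsLocallyRationalGL P B := fun a b => (hA a b).congr fun m hm => by rw [h m hm]

theorem const (g : GeneralLinearGroup (Fin k) ℂ) : IsLocallyRationalGL P fun _ => g :=
  fun _ _ => .const _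

theorem entry (i : ι) : IsLocallyRationalGL P fun m => m i := fun _ _ => .entry _ _ _

theorem mul (hA : IsLocallyRationalGL P A) (hB : IsLocallyRationalGL P B) :
    IsLocallyRationalGL P fun m => A m * B m := fun a b => by
  simp only [Units.val_mul, Matrix.mul_apply]
  exact .sum _ fun c _ => (hA _ _).mul (hB _ _)

theorem inv (hA : IsLocallyRationalGL P A) : IsLocallyRationalGL P fun m => (A m)⁻¹ := fun a b => by
  -- Cramer's rule: the numerator is an entry of the adjugate.
  refine IsLocallyRational.congr (f := fun m => ((A m).val.updateRow b (Pi.single a 1)).det /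
    (A m).val.det) (.div (.det fun i j => ?_) (.det hA) fun m _ => det_ne_zero _) fun m _ => ?_
  · simp only [updateRow_apply]
    split_ifs
    · exact .const _
    · exact hA _ _
  · rw [coe_units_inv, Matrix.inv_def, Matrix.smul_apply, adjugate_apply, Ring.inverse_eq_inv',
      smul_eq_mul, div_eq_inv_mul]

theorem cornerMinor (hA : IsLocallyRationalGL P A) (p j : Fin k) :
    IsLocallyRational P fun m => cornerMinor (A m).val p j :=
  .det fun _ _ => hA _ _

end IsLocallyRationalGL

/-! ### Regular functions and morphisms -/

variable {S : Set (ι → CompleteFlag k)} {T : Set (κ → CompleteFlag k)}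

theorem isRegularOn_of_isLocallyRational {V : Set S} {F : S → ℂ}
    (hf : IsLocallyRational {m | ∃ hm : flagTuple m ∈ S, ⟨flagTuple m, hm⟩ ∈ V} f)
    (h : ∀ m (hm : flagTuple m ∈ S), ⟨flagTuple m, hm⟩ ∈ V → F ⟨flagTuple m, hm⟩ = f m) :
    IsRegularOn V F := by
  intro m hm hV
  obtain ⟨p, q, h0, h1⟩ := hf m ⟨hm, hV⟩
  exact ⟨p, q, h0, fun n hn hV' hne => by rw [h n hn hV', h1 n ⟨hn, hV'⟩ hne]⟩

/-- A map of varieties that lifts to locally rational matrices is a morphism. -/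
theorem isMorphism_of_lift {φ : S → T}
    (A : (ι → GeneralLinearGroup (Fin k) ℂ) → κ → GeneralLinearGroup (Fin k) ℂ)
    (hA : ∀ c, IsLocallyRationalGL {m | flagTuple m ∈ S} fun m => A m c)
    (hφ : ∀ m (hm : flagTuple m ∈ S), (φ ⟨flagTuple m, hm⟩).val = flagTuple (A m)) :
    IsMorphism φ := by
  have hT (m) (hm : flagTuple m ∈ S) : flagTuple (A m) ∈ T := hφ m hm ▸ (φ _).2
  have hφ' (m) (hm : flagTuple m ∈ S) : φ ⟨flagTuple m, hm⟩ = ⟨flagTuple (A m), hT m hm⟩ :=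
    Subtype.ext (hφ m hm)
  refine ⟨?_, fun V F hV hF => ?_⟩
  · refine @Continuous.mk S T (zariski S) (zariski T) φ fun V hV m hm hmV => ?_
    have hmV' : (⟨flagTuple (A m), hT m hm⟩ : T) ∈ V := hφ' m hm ▸ hmV
    obtain ⟨h, h0, h1⟩ := hV (A m) (hT m hm) hmV'
    have hloc := (IsLocallyRational.of_polynomial (P := Set.univ) h).comp
      (fun c => hA c) (fun _ _ => Set.mem_univ _)
    obtain ⟨p, q, a, b⟩ := hloc m hm
    beta_reduce at b
    have hp : evalAt m p ≠ 0 := by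
      have := b m hm a
      rw [this] at h0
      exact (div_ne_zero_iff.mp h0).1
    -- Where `p * q` is nonzero, the pullback of `h` equals `p / q` and is nonzero too.
    refine ⟨p * q, by rw [evalAt_mul]; exact mul_ne_zero hp a, fun n hn hne => ?_⟩
    rw [evalAt_mul] at hne
    change φ _ ∈ V
    rw [hφ' n hn]
    refine h1 _ _ ?_
    rw [b n hn (right_ne_zero_of_mul hne)]
    exact div_ne_zero (left_ne_zero_of_mul hne) (right_ne_zero_of_mul hne)
  · classical
    -- Extension by zero to all tuples of matrices; only values over `V` are used.
    let F' : (κ → GeneralLinearGroup (Fin k) ℂ) → ℂ := fun m =>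
      if hm : flagTuple m ∈ T then F ⟨flagTuple m, hm⟩ else 0
    have hF' : IsLocallyRational {m | ∃ hm : flagTuple m ∈ T, ⟨flagTuple m, hm⟩ ∈ V} F' := by
      intro m hm
      obtain ⟨p, q, h0, h1⟩ := hF m hm.1 hm.2
      refine ⟨p, q, h0, fun n hn hne => ?_⟩
      rw [← h1 n hn.1 hn.2 hne]
      exact dif_pos hn.1
    refine isRegularOn_of_isLocallyRational (f := fun m => F' (A m)) (hF'.comp ?_ ?_) ?_
    · intro c a b m hm
      obtain ⟨p, q, h0, h1⟩ := hA c a b m hm.1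
      exact ⟨p, q, h0, fun n hn => h1 n hn.1⟩
    · rintro m ⟨hm, hmV⟩
      exact ⟨hT m hm, hφ' m hm ▸ hmV⟩
    · intro m hm _
      change F (φ _) = _
      rw [hφ' m hm]
      exact (dif_pos (c := flagTuple (A m) ∈ T)
        (t := fun hm => F ⟨flagTuple (A m), hm⟩) (e := fun _ => 0) (hT m hm)).symm

end LocallyRational

/-! ### Reduced words -/

section Words

variable {k : ℕ}

theorem wordPerm_nil : wordPerm ([] : List (Fin (k - 1))) = 1 := rfl

theorem wordPerm_cons (i : Fin (k - 1)) (γ : List (Fin (k - 1))) :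
    wordPerm (i :: γ) = simpleTransposition i * wordPerm γ := by
  simp [wordPerm]

theorem wordPerm_append (γ γ' : List (Fin (k - 1))) :
    wordPerm (γ ++ γ') = wordPerm γ * wordPerm γ' := by
  simp [wordPerm]

theorem wordPerm_take_succ (γ : List (Fin (k - 1))) {j : ℕ} (hj : j < γ.length) :
    wordPerm (γ.take (j + 1)) = wordPerm (γ.take j) * simpleTransposition γ[j] := by
  rw [← List.take_concat_get' γ j hj, wordPerm_append, wordPerm_cons, wordPerm_nil, mul_one]

theorem wordPerm_reverse (γ : List (Fin (k - 1))) : wordPerm γ.reverse = (wordPerm γ)⁻¹ := by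
  induction γ with
  | nil => simp [wordPerm_nil]
  | cons i γ ih =>
    rw [List.reverse_cons, wordPerm_append, ih, wordPerm_cons, wordPerm_cons, wordPerm_nil,
      mul_one, _root_.mul_inv_rev, simpleTransposition_inv]

theorem permLength_le (γ : List (Fin (k - 1))) : permLength (wordPerm γ) ≤ γ.length :=
  Nat.sInf_le ⟨γ, rfl, rfl⟩

theorem permLength_inv (w : Equiv.Perm (Fin k)) : permLength w⁻¹ = permLength w := by
  have key (n : ℕ) (u : Equiv.Perm (Fin k))
      (h : ∃ β : List (Fin (k - 1)), β.length = n ∧ wordPerm β = u) :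
      ∃ β : List (Fin (k - 1)), β.length = n ∧ wordPerm β = u⁻¹ := by
    obtain ⟨β, h1, h2⟩ := h
    exact ⟨β.reverse, by rw [List.length_reverse, h1], by rw [wordPerm_reverse, h2]⟩
  unfold permLength
  congr 1
  ext n
  exact ⟨fun h => by simpa using key n _ h, key n w⟩

theorem IsReducedWord.reverse {γ : List (Fin (k - 1))} {w : Equiv.Perm (Fin k)}
    (h : IsReducedWord γ w) : IsReducedWord γ.reverse w⁻¹ :=
  ⟨by rw [wordPerm_reverse, h.1], by rw [List.length_reverse, h.2, permLength_inv]⟩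

/-- The exchange property: a transposition that creates a descent shortens the word. -/
theorem exists_word_mul_swap (γ : List (Fin (k - 1))) {p q : Fin k} (hpq : p < q)
    (h : wordPerm γ q < wordPerm γ p) :
    ∃ γ' : List (Fin (k - 1)), γ'.length + 1 = γ.length ∧
      wordPerm γ' = wordPerm γ * Equiv.swap p q := by
  induction γ with
  | nil => exact absurd h (not_lt.mpr hpq.le)
  | cons i γ ih =>
    rcases lt_or_gt_of_ne ((wordPerm γ).injective.ne hpq.ne) with hlt | hlt
    · rw [wordPerm_cons] at h ⊢
      -- The tail keeps `p` and `q` in order, so the letter `i` alone inverts them; deleting it has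
      -- the effect of the swap.
      have hi : wordPerm γ p = lowerStrand i ∧ wordPerm γ q = upperStrand i := by
        by_contra hi
        exact lt_asymm h (simpleTransposition_lt i hlt hi)
      refine ⟨γ, rfl, ?_⟩
      rw [simpleTransposition_eq, ← hi.1, ← hi.2, mul_assoc, Equiv.mul_swap_eq_swap_mul,
        Equiv.swap_mul_self_mul]
    · obtain ⟨γ', h1, h2⟩ := ih hlt
      exact ⟨i :: γ', by simp [h1], by rw [wordPerm_cons, wordPerm_cons, h2, mul_assoc]⟩

/-- Every letter of the word increases the length of the permutation. -/
def IsAscending (γ : List (Fin (k - 1))) : Prop :=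
  ∀ (j : ℕ) (hj : j < γ.length),
    wordPerm (γ.take j) (lowerStrand γ[j]) < wordPerm (γ.take j) (upperStrand γ[j])

/-- At a descent, exchange would replace a prefix together with its next letter by a word two
letters shorter, contradicting minimality. -/
theorem IsReducedWord.isAscending {γ : List (Fin (k - 1))} {w : Equiv.Perm (Fin k)}
    (h : IsReducedWord γ w) : IsAscending γ := by
  intro j hj
  by_contra hlt
  have hne := (wordPerm (γ.take j)).injective.ne (lowerStrand_lt_upperStrand γ[j]).ne
  obtain ⟨γ', h1, h2⟩ := exists_word_mul_swap (γ.take j) (lowerStrand_lt_upperStrand γ[j])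
    (lt_of_le_of_ne (not_lt.mp hlt) hne.symm)
  have hw : wordPerm (γ' ++ γ.drop (j + 1)) = w := by
    rw [wordPerm_append, h2, ← simpleTransposition_eq, ← wordPerm_take_succ, ← wordPerm_append,
      List.take_append_drop, h.1]
  have := permLength_le (γ' ++ γ.drop (j + 1))
  rw [hw, ← h.2, List.length_append, List.length_drop] at this
  rw [List.length_take] at h1
  omega

/-- The inversions of a prefix of an ascending word are inversions of the word. -/
theorem IsAscending.lt_of_lt {γ : List (Fin (k - 1))} (h : IsAscending γ) {p q : Fin k}
    (hpq : p < q) {l n : ℕ} (hln : l ≤ n) (hn : n ≤ γ.length)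
    (hlt : (wordPerm (γ.take n))⁻¹ p < (wordPerm (γ.take n))⁻¹ q) :
    (wordPerm (γ.take l))⁻¹ p < (wordPerm (γ.take l))⁻¹ q := by
  induction n, hln using Nat.le_induction with
  | base => exact hlt
  | succ n _ ih =>
    refine ih (by omega) ?_
    set u := wordPerm (γ.take n) with hu
    rw [wordPerm_take_succ γ (by omega), ← hu, _root_.mul_inv_rev, simpleTransposition_inv] at hlt
    by_contra hcon
    have hgt : u⁻¹ q < u⁻¹ p :=
      lt_of_le_of_ne (not_lt.mp hcon) (u⁻¹.injective.ne hpq.ne').symm.symm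
    -- The letter reorders only its own pair of strands, and ascent forbids that pair from being
    -- inverted already.
    by_cases hs : u⁻¹ q = lowerStrand γ[n] ∧ u⁻¹ p = upperStrand γ[n]
    · have := h n (by omega)
      rw [← hu, ← hs.1, ← hs.2] at this
      exact lt_asymm hpq (by simpa using this)
    · exact lt_asymm hlt (simpleTransposition_lt _ hgt hs)

end Words

/-! ### Paths of flags -/

section Paths

variable {k : ℕ}

/-- Consecutive flags of the sequence are in the relative positions given by the word. -/
def IsPath (γ : List (Fin (k - 1))) (f : ℕ → CompleteFlag k) : Prop :=
  ∀ (j : ℕ) (hj : j < γ.length), RelPos (f j) (simpleTransposition γ[j]) (f (j + 1))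

theorem IsPath.smul {γ : List (Fin (k - 1))} {f : ℕ → CompleteFlag k} (h : IsPath γ f)
    (g : GeneralLinearGroup (Fin k) ℂ) : IsPath γ fun j => g • f j :=
  fun j hj => (h j hj).smul g

theorem IsPath.congr {γ : List (Fin (k - 1))} {f f' : ℕ → CompleteFlag k} (h : IsPath γ f)
    (hf : ∀ j ≤ γ.length, f' j = f j) : IsPath γ f' := fun j hj => by
  rw [hf j hj.le, hf (j + 1) hj]
  exact h j hj

theorem isPath_append {γ γ' : List (Fin (k - 1))} {f : ℕ → CompleteFlag k} :
    IsPath (γ ++ γ') f ↔ IsPath γ f ∧ IsPath γ' fun j => f (γ.length + j) := by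
  constructor
  · intro h
    refine ⟨fun j hj => ?_, fun j hj => ?_⟩
    · have := h j (by rw [List.length_append]; omega)
      rwa [List.getElem_append_left hj] at this
    · have := h (γ.length + j) (by rw [List.length_append]; omega)
      rwa [List.getElem_append_right (by omega), getElem_congr_idx (Nat.add_sub_cancel_left ..)]
        at this
  · rintro ⟨h1, h2⟩ j hj
    rw [List.length_append] at hj
    by_cases hlt : j < γ.length
    · rw [List.getElem_append_left hlt]
      exact h1 j hlt
    · obtain ⟨i, rfl⟩ := Nat.exists_eq_add_of_le (not_lt.mp hlt)
      rw [List.getElem_append_right (by omega), getElem_congr_idx (Nat.add_sub_cancel_left ..)]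
      exact h2 i (by omega)

theorem isPath_coordFlag (u : Equiv.Perm (Fin k)) (γ : List (Fin (k - 1))) :
    IsPath γ fun j => coordFlag (u * wordPerm (γ.take j)) := fun j hj => by
  beta_reduce
  rw [wordPerm_take_succ γ hj, ← mul_assoc]
  exact relPos_coordFlag _ _

theorem IsPath.reverse {γ : List (Fin (k - 1))} {f : ℕ → CompleteFlag k} (h : IsPath γ f) :
    IsPath γ.reverse fun j => f (γ.length - j) := by
  intro j hj
  rw [List.length_reverse] at hj
  have := (h (γ.length - 1 - j) (by omega)).symm
  rw [simpleTransposition_inv] at this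
  rw [List.getElem_reverse]
  rw [show γ.length - 1 - j + 1 = γ.length - j by omega] at this
  beta_reduce
  rw [show γ.length - (j + 1) = γ.length - 1 - j by omega]
  exact this

/-- `M` is upper triangular with ones on the diagonal. -/
def IsUnitUpper (M : GeneralLinearGroup (Fin k) ℂ) : Prop :=
  IsUnitLower (permGL (longest k) * M * permGL (longest k))

theorem permGL_longest_mul_self : permGL (longest k) * permGL (longest k) = 1 := by
  rw [← permGL_mul, longest_mul_longest, permGL_one]

theorem IsUnitUpper.isUpperTriangular {M : GeneralLinearGroup (Fin k) ℂ} (h : IsUnitUpper M) :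
    M.val.IsUpperTriangular :=
  isLowerTriangular_longest_conj.mp h.isLowerTriangular

theorem IsUnitUpper.mul {M N : GeneralLinearGroup (Fin k) ℂ} (hM : IsUnitUpper M)
    (hN : IsUnitUpper N) : IsUnitUpper (M * N) := by
  have := IsUnitLower.mul hM hN
  rwa [mul_assoc, mul_assoc (permGL (longest k)) N, ← mul_assoc (permGL (longest k)) (permGL _),
    permGL_longest_mul_self, one_mul, ← mul_assoc, mul_assoc _ M N] at this

theorem IsUnitUpper.one : IsUnitUpper (1 : GeneralLinearGroup (Fin k) ℂ) := by
  rw [IsUnitUpper, mul_one, permGL_longest_mul_self]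
  exact IsUnitLower.one

theorem isUnitUpper_rootGL {p q : Fin k} (hpq : p < q) (z : ℂ) :
    IsUnitUpper (rootGL p q hpq.ne z) := by
  refine ⟨fun i j hij => ?_, fun i => ?_⟩
  · rw [longest_conj_apply]
    exact rootGL_isUpperTriangular hpq z (by simpa using hij)
  · rw [longest_conj_apply, rootGL_apply, if_pos rfl, if_neg, add_zero]
    rintro ⟨h1, h2⟩
    exact hpq.ne (h1.trans h2.symm)

/-- A path along an ascending word that starts at the standard flag is a unipotent translate of
the path of coordinate flags. -/
theorem IsAscending.exists_unitUpper {γ : List (Fin (k - 1))} (hγ : IsAscending γ)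
    {f : ℕ → CompleteFlag k} (h0 : f 0 = stdFlag k) (hf : IsPath γ f) {n : ℕ}
    (hn : n ≤ γ.length) :
    ∃ U : GeneralLinearGroup (Fin k) ℂ, IsUnitUpper U ∧
      ∀ j ≤ n, f j = U • coordFlag (wordPerm (γ.take j)) := by
  induction n with
  | zero =>
    refine ⟨1, IsUnitUpper.one, fun j hj => ?_⟩
    rw [Nat.le_zero.mp hj, List.take_zero, wordPerm_nil, one_smul, h0, stdFlag]
  | succ n ih =>
    obtain ⟨U, hU, hUf⟩ := ih (by omega)
    have hlt := hγ n hn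
    have hrel := hf n hn
    set u := wordPerm (γ.take n) with hu
    rw [hUf n le_rfl, coordFlag, smul_flagOf, ← hu] at hrel
    obtain ⟨z, hz⟩ := hrel.exists_crossing
    -- The root matrix of the crossing moved to the left of `u`; ascent puts its entry above the
    -- diagonal.
    set X := rootGL _ _ hlt.ne z with hX
    refine ⟨U * X, hU.mul (isUnitUpper_rootGL hlt z), fun j hj => ?_⟩
    rcases Nat.le_succ_iff.mp hj with hj | rfl
    · rw [hUf j hj, mul_smul]
      congr 1
      symm
      rw [smul_coordFlag_eq_self_iff]
      intro a b hab
      rw [hX, rootGL_apply, if_neg (by rintro rfl; exact lt_irrefl _ hab), if_neg, add_zero]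
      rintro ⟨rfl, rfl⟩
      -- The pair of positions of `X` is not inverted by `u`, hence by no earlier prefix, so `X`
      -- fixes all the earlier coordinate flags.
      refine lt_asymm hab (hγ.lt_of_lt hlt hj (by omega) ?_)
      rw [← hu]
      simpa using lowerStrand_lt_upperStrand γ[n]
    · rw [hz, wordPerm_take_succ γ hn, ← hu, coordFlag, smul_flagOf, permGL_mul, crossing, hX]
      congr 1
      rw [mul_assoc U (permGL u), ← mul_assoc (permGL u), permGL_mul_rootGL]
      simp only [mul_assoc]

/-- Unipotent translates of the path of coordinate flags along an ascending word are determined by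
their end points. -/
theorem IsAscending.smul_coordFlag_eq {γ : List (Fin (k - 1))} (hγ : IsAscending γ)
    {U V : GeneralLinearGroup (Fin k) ℂ} (hU : U.val.IsUpperTriangular)
    (hV : V.val.IsUpperTriangular)
    (h : U • coordFlag (wordPerm γ) = V • coordFlag (wordPerm γ)) {j : ℕ} (hj : j ≤ γ.length) :
    U • coordFlag (wordPerm (γ.take j)) = V • coordFlag (wordPerm (γ.take j)) := by
  rw [← inv_smul_eq_iff, smul_smul] at h ⊢
  rw [smul_coordFlag_eq_self_iff] at h ⊢
  intro a b hab
  -- Above the diagonal, the entries that must vanish correspond to inversions of the prefix. These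
  -- are inversions of the whole word, where the equality of end points applies.
  rcases lt_trichotomy a b with hlt | rfl | hlt
  · refine h a b (lt_of_not_ge fun hge => lt_asymm hab (hγ.lt_of_lt hlt hj le_rfl ?_))
    rw [List.take_length]
    exact lt_of_le_of_ne hge ((wordPerm γ)⁻¹.injective.ne hlt.ne)
  · exact absurd hab (lt_irrefl _)
  · exact blockTriangular_mul (blockTriangular_inv hV) hU hlt

end Paths

/-! ### Transversality to coordinate flags -/

section Transversality

variable {k : ℕ}

theorem cornerMinor_lower_ne_zero {L : GeneralLinearGroup (Fin k) ℂ}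
    (hL : L.val.IsLowerTriangular) (j : Fin k) : cornerMinor L.val j j ≠ 0 := by
  have hdet := det_ne_zero L
  rw [det_of_isLowerTriangular _ hL, Finset.prod_ne_zero_iff] at hdet
  rw [cornerMinor_self, det_of_isLowerTriangular, Finset.prod_ne_zero_iff]
  · exact fun a _ => hdet _ (Finset.mem_univ _)
  · intro a b hab
    exact hL hab

theorem exists_unitLower_of_cornerMinor {A : GeneralLinearGroup (Fin k) ℂ}
    (h : ∀ j, cornerMinor A.val j j ≠ 0) :
    ∃ L : GeneralLinearGroup (Fin k) ℂ, IsUnitLower L ∧ flagOf A = flagOf L := by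
  obtain ⟨L, U, hL, -, hU, rfl⟩ :=
    -- A constant `σ` makes the block condition vacuous.
    exists_lu_of_cornerMinor h (σ := fun _ => (0 : ℕ)) fun _ _ h => absurd h (lt_irrefl _)
  exact ⟨L, hL, flagOf_mul_upper hU⟩

theorem coordFlag_longest_mul (w : Equiv.Perm (Fin k)) :
    coordFlag (longest k * w) = permGL (longest k * w * longest k) • antFlag k := by
  rw [antFlag, permGL_smul_coordFlag, mul_assoc _ (longest k), longest_mul_longest, mul_one]

/-- The big cell: flags transverse to a coordinate flag. -/
theorem transverse_iff_exists_unitLower {F : CompleteFlag k} {w : Equiv.Perm (Fin k)} :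
    Transverse F (coordFlag (longest k * w)) ↔
      ∃ L, IsUnitLower L ∧ F = flagOf (permGL (longest k * w * longest k) * L) := by
  rw [coordFlag_longest_mul]
  set u := permGL (longest k * w * longest k) with hu
  constructor
  · rintro ⟨g, h1, h2⟩
    have hlow : (g * u).val.IsLowerTriangular := by
      rwa [← smul_antFlag_eq_self_iff, mul_smul]
    -- Here `F = u(gu)⁻¹F^std` with `(gu)⁻¹` lower triangular; the LU decomposition only normalises
    -- its diagonal.
    obtain ⟨L, hL, hL'⟩ := exists_unitLower_of_cornerMinor
      (cornerMinor_lower_ne_zero (blockTriangular_inv hlow))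
    refine ⟨L, hL, ?_⟩
    rw [← smul_flagOf, ← hL', smul_flagOf, _root_.mul_inv_rev, mul_inv_cancel_left, flagOf_eq_smul,
      ← h1, inv_smul_smul]
  · rintro ⟨L, hL, rfl⟩
    refine ⟨(u * L)⁻¹, ?_, ?_⟩
    · rw [smul_flagOf, inv_mul_cancel, stdFlag_eq]
    · rw [_root_.mul_inv_rev, mul_smul, inv_smul_smul]
      exact smul_antFlag_eq_self_iff.mpr hL.inv.isLowerTriangular

/-- This describes the big cell translated by `g` by equations in an arbitrary matrix representing
the flag. -/
theorem exists_unitLower_iff_cornerMinor {g M : GeneralLinearGroup (Fin k) ℂ} :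
    (∃ L, IsUnitLower L ∧ flagOf M = flagOf (g * L)) ↔
      ∀ j, cornerMinor (g⁻¹ * M).val j j ≠ 0 := by
  constructor
  · rintro ⟨L, hL, h⟩ j
    obtain ⟨U, hU, rfl⟩ := flagOf_eq_mul_upper h
    rw [mul_assoc, inv_mul_cancel_left]
    exact cornerMinor_ne_zero_of_lu hL hU j
  · intro h
    obtain ⟨L, hL, h'⟩ := exists_unitLower_of_cornerMinor h
    exact ⟨L, hL, by rw [← smul_flagOf, ← h', smul_flagOf, mul_inv_cancel_left]⟩

/-- The lower unitriangular matrix of a point of a big cell, in terms of minors. -/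
theorem unitLower_apply {g L M : GeneralLinearGroup (Fin k) ℂ} (hL : IsUnitLower L)
    (h : flagOf M = flagOf (g * L)) (i j : Fin k) :
    L.val i j = cornerMinor (g⁻¹ * M).val i j / cornerMinor (g⁻¹ * M).val j j := by
  obtain ⟨U, hU, rfl⟩ := flagOf_eq_mul_upper h
  rw [mul_assoc, inv_mul_cancel_left]
  exact unitLower_apply_of_lu hL hU i j

/-- Every flag is transverse to a coordinate flag. -/
theorem exists_transverse_coordFlag (M : GeneralLinearGroup (Fin k) ℂ) :
    ∃ w, Transverse (flagOf M) (coordFlag (longest k * w)) := by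
  obtain ⟨v, hv⟩ := exists_perm_cornerMinor_ne_zero (det_ne_zero M)
  -- Chosen so that `w₀ww₀` is the row permutation `v`.
  refine ⟨longest k * v * longest k, ?_⟩
  have : longest k * (longest k * v * longest k) * longest k = v := by
    rw [mul_assoc _ _ (longest k), mul_assoc _ _ (longest k), longest_mul_longest, mul_one,
      ← mul_assoc, longest_mul_longest, one_mul]
  rw [transverse_iff_exists_unitLower, this, exists_unitLower_iff_cornerMinor]
  intro j
  convert hv j using 2
  ext a b
  rw [← permGL_inv, permGL_mul_apply, inv_inv]
  rfl

end Transversality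

/-! ### The flags of a braid variety lift to matrices -/

section Lift

variable {k : ℕ}

theorem crossing_apply (i : Fin (k - 1)) (z : ℂ) (a b : Fin k) :
    (crossing i z).val a b =
      (rootGL (lowerStrand i) (upperStrand i) (lowerStrand_lt_upperStrand i).ne z).val a
        (simpleTransposition i b) :=
  mul_permGL_apply _ _ _ _

theorem cornerMinor_crossing (i : Fin (k - 1)) (z : ℂ) (p : Fin k) :
    cornerMinor (crossing i z).val p (lowerStrand i) = (crossing i z).val p (lowerStrand i) := by
  have hne {a b : Fin k} (ha : a < lowerStrand i) (hab : a = simpleTransposition i b) : a = b := by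
    rw [← Equiv.Perm.inv_eq_iff_eq, simpleTransposition_inv, simpleTransposition_eq,
      Equiv.swap_apply_of_ne_of_ne ha.ne (ha.trans (lowerStrand_lt_upperStrand i)).ne] at hab
    exact hab
  refine cornerMinor_eq_entry _ _ (fun a b ha hab _ => ?_) fun a ha => ?_
  · rw [crossing_apply, rootGL_apply, if_neg fun h => hab.ne (hne ha h),
      if_neg fun h => ha.ne h.1.symm, add_zero]
  · rw [crossing_apply, rootGL_apply, simpleTransposition_eq,
      Equiv.swap_apply_of_ne_of_ne ha.ne (ha.trans (lowerStrand_lt_upperStrand i)).ne, if_pos rfl,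
      if_neg fun h => ha.ne h.1.symm, add_zero]

theorem crossing_lower (i : Fin (k - 1)) (z : ℂ) :
    (crossing i z).val (lowerStrand i) (lowerStrand i) = z := by
  rw [crossing_apply, rootGL_apply, simpleTransposition_eq, Equiv.swap_apply_left,
    if_neg (lowerStrand_lt_upperStrand i).ne, if_pos ⟨rfl, rfl⟩, zero_add]

theorem crossing_upper (i : Fin (k - 1)) (z : ℂ) :
    (crossing i z).val (upperStrand i) (lowerStrand i) = 1 := by
  rw [crossing_apply, rootGL_apply, simpleTransposition_eq, Equiv.swap_apply_left,
    if_pos rfl, if_neg fun h => (lowerStrand_lt_upperStrand i).ne h.1, add_zero]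

/-- The parameter of a crossing is a ratio of minors with nonvanishing denominator, hence regular.
-/
theorem cornerMinor_of_flagOf_crossing {i : Fin (k - 1)} {z : ℂ}
    {M : GeneralLinearGroup (Fin k) ℂ} (h : flagOf M = flagOf (crossing i z)) :
    cornerMinor M.val (upperStrand i) (lowerStrand i) ≠ 0 ∧
      z = cornerMinor M.val (lowerStrand i) (lowerStrand i) /
        cornerMinor M.val (upperStrand i) (lowerStrand i) := by
  obtain ⟨U, hU, rfl⟩ := flagOf_eq_mul_upper h
  have hne := cornerMinor_upper_ne_zero hU (det_ne_zero U) (lowerStrand i)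
  rw [Units.val_mul, cornerMinor_mul_upper _ hU, cornerMinor_mul_upper _ hU, cornerMinor_crossing,
    cornerMinor_crossing, crossing_lower, crossing_upper, one_mul, mul_div_cancel_right₀ _ hne]
  exact ⟨hne, rfl⟩

theorem IsLocallyRational.crossing {ι : Type} {P : Set (ι → GeneralLinearGroup (Fin k) ℂ)}
    {f : (ι → GeneralLinearGroup (Fin k) ℂ) → ℂ} (hf : IsLocallyRational P f) (i : Fin (k - 1)) :
    IsLocallyRationalGL P fun m => crossing i (f m) := by
  intro a b
  simp only [crossing_apply, rootGL_apply]
  refine .add (.const _) ?_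
  split_ifs
  · exact hf
  · exact .const _

/-- The flags of a point of a braid variety are the flags of matrices whose entries are regular
functions on the braid variety. -/
theorem exists_regular_lift (β : List (Fin (k - 1))) {n : ℕ} (hn : n < β.length + 1) :
    ∃ A : (Fin (β.length + 1) → CompleteFlag k) → GeneralLinearGroup (Fin k) ℂ,
      (∀ F ∈ braidVariety β, F ⟨n, hn⟩ = flagOf (A F)) ∧
      IsLocallyRationalGL {m | flagTuple m ∈ braidVariety β} fun m => A (flagTuple m) := by
  induction n with
  | zero => exact ⟨fun _ => 1, fun F hF => hF.1.trans stdFlag_eq, .const 1⟩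
  | succ n ih =>
    obtain ⟨A, hA, hA'⟩ := ih (by omega)
    set i := β[n] with hi
    have hz (F : Fin (β.length + 1) → CompleteFlag k) :
        ∃ z, F ∈ braidVariety β → F ⟨n + 1, hn⟩ = flagOf (A F * crossing i z) := by
      by_cases hF : F ∈ braidVariety β
      · have hrel : RelPos (F ⟨n, by omega⟩) (simpleTransposition i) (F ⟨n + 1, hn⟩) :=
          hF.2.2 ⟨n, by omega⟩
        rw [hA F hF] at hrel
        obtain ⟨z, hz⟩ := hrel.exists_crossing
        exact ⟨z, fun _ => hz⟩
      · exact ⟨0, fun h => absurd h hF⟩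
    choose z hz using hz
    refine ⟨fun F => A F * crossing i (z F), hz, hA'.mul (.crossing ?_ i)⟩
    -- Translating by the inverse of the lift found so far brings the next flag into the line of
    -- crossings at the standard flag.
    have hminor {m} (hm : flagTuple m ∈ braidVariety β) :=
      cornerMinor_of_flagOf_crossing (i := i) (z := z (flagTuple m))
        (M := (A (flagTuple m))⁻¹ * m ⟨n + 1, hn⟩) (by
          have : flagOf (m ⟨n + 1, hn⟩) = _ := hz _ hm
          rw [← smul_flagOf, this, smul_flagOf, inv_mul_cancel_left])
    have hreg := hA'.inv.mul (.entry ⟨n + 1, hn⟩)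
    exact ((hreg.cornerMinor _ _).div (hreg.cornerMinor _ _) fun m hm => (hminor hm).1).congr
      fun m hm => (hminor hm).2

/-- The defining function is the product of the leading minors of `u⁻¹A`; it depends on the flags
alone because `A` is the regular lift, not an arbitrary representative. -/
theorem isPrincipalOpen_splicingLocus (β : List (Fin (k - 1))) (r₁ : Fin (β.length + 1))
    (w : Equiv.Perm (Fin k)) : IsPrincipalOpen (braidVariety β) (splicingLocus β r₁ w) := by
  obtain ⟨A, hA, hA'⟩ := exists_regular_lift β r₁.isLt
  set u := permGL (longest k * w * longest k) with hu
  refine ⟨fun F hF => hF.1, fun F => ∏ j, cornerMinor (u⁻¹ * A F.val).val j j, ?_, fun F => ?_⟩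
  · refine isRegularOn_of_isLocallyRational
      (f := fun m => ∏ j, cornerMinor (u⁻¹ * A (flagTuple m)).val j j) ?_ fun _ _ _ => rfl
    intro m hm
    have := IsLocallyRational.prod Finset.univ fun j _ =>
      (((IsLocallyRationalGL.const u⁻¹).mul hA').cornerMinor j j)
    obtain ⟨p, q, h0, h1⟩ := this m hm.1
    exact ⟨p, q, h0, fun n hn => h1 n hn.1⟩
  · rw [Finset.prod_ne_zero_iff]
    simp only [Finset.mem_univ, true_implies]
    rw [← exists_unitLower_iff_cornerMinor, ← hA F.val F.2, ← transverse_iff_exists_unitLower]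
    exact ⟨fun h => h.2, fun h => ⟨F.2, h⟩⟩

theorem iUnion_splicingLocus (β : List (Fin (k - 1))) (r₁ : Fin (β.length + 1)) :
    ⋃ w : Equiv.Perm (Fin k), splicingLocus β r₁ w = braidVariety β := by
  refine Set.Subset.antisymm (Set.iUnion_subset fun w F hF => hF.1) fun F hF => ?_
  obtain ⟨A, hA, -⟩ := exists_regular_lift β r₁.isLt
  obtain ⟨w, hw⟩ := exists_transverse_coordFlag (A F)
  rw [← hA F hF] at hw
  exact Set.mem_iUnion.mpr ⟨w, hF, hw⟩

end Lift

/-! ### Lower unitriangular matrices and pairs of opposite flags -/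

section OppositeFlags

variable {k : ℕ}

/-- Pulling the order back along `b` makes the matrix upper triangular. This serves orders twisted
by a permutation. -/
theorem det_of_blockTriangular_injective {m α : Type*} [Fintype m] [DecidableEq m] [LinearOrder α]
    {M : Matrix m m ℂ} {b : m → α} (hM : M.BlockTriangular b) (hb : Function.Injective b) :
    M.det = ∏ i, M i i := by
  let _ : LinearOrder m := LinearOrder.lift' b hb
  exact det_of_isUpperTriangular (M := M) fun i j hij => hM hij

theorem smul_antFlag_of_lower {L : GeneralLinearGroup (Fin k) ℂ} (hL : L.val.IsLowerTriangular) :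
    L • antFlag k = antFlag k :=
  smul_antFlag_eq_self_iff.mpr hL

theorem smul_stdFlag_of_upper {U : GeneralLinearGroup (Fin k) ℂ} (hU : U.val.IsUpperTriangular) :
    U • stdFlag k = stdFlag k := by
  rwa [← flagOf_eq_smul, flagOf_eq_stdFlag_iff]

/-- Unipotent translates of two opposite coordinate flags are translates by a common matrix. -/
theorem exists_common_unitLower {N₁ N₂ : GeneralLinearGroup (Fin k) ℂ} (h₁ : IsUnitLower N₁)
    (h₂ : IsUnitLower N₂) (v : Equiv.Perm (Fin k)) :
    ∃ N : GeneralLinearGroup (Fin k) ℂ, IsUnitLower N ∧ N • coordFlag v = N₂ • coordFlag v ∧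
      N • coordFlag (v * longest k) = N₁ • coordFlag (v * longest k) := by
  have hX := h₁.inv.mul h₂
  set X := N₁⁻¹ * N₂ with hXdef
  set A := permGL v⁻¹ * X * permGL v with hA
  have hAX (i j : Fin k) : A.val i j = X.val (v i) (v j) := by
    rw [hA, mul_permGL_apply, permGL_mul_apply, inv_inv]
  have hσ : A.val.BlockTriangular (OrderDual.toDual ∘ v) := fun i j hij => by
    rw [hAX]
    exact hX.1 _ _ hij
  -- `A` is unitriangular for the order twisted by `v`, so every leading minor equals one.
  have hminor (j : Fin k) : cornerMinor A.val j j ≠ 0 := by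
    rw [cornerMinor_self, det_of_blockTriangular_injective hσ.submatrix
      ((OrderDual.toDual.injective.comp v.injective).comp (Fin.castLE_injective _))]
    simp only [submatrix_apply, hAX, hX.2, Finset.prod_const_one]
    exact one_ne_zero
  obtain ⟨L, U, hL, hLσ, hU, hLU⟩ := exists_lu_of_cornerMinor hminor hσ
  have hconj : IsUnitLower (permGL v * L * permGL v⁻¹) := by
    refine ⟨fun i j hij => ?_, fun i => ?_⟩
    · rw [permGL_conj_apply]
      refine hLσ ?_
      simpa using hij
    · rw [permGL_conj_apply, hL.2]
  have hv : permGL v⁻¹ * permGL v = 1 := by rw [← permGL_mul, inv_mul_cancel, permGL_one]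
  -- The conjugate of `L` fixes `F(vw₀)`, because `L` fixes the antistandard flag. On `F(v)` the
  -- missing factor `U` is invisible, and with it the product becomes `N₂v`.
  refine ⟨N₁ * (permGL v * L * permGL v⁻¹), h₁.mul hconj, ?_, ?_⟩
  · rw [coordFlag, smul_flagOf, smul_flagOf, ← flagOf_mul_upper hU]
    congr 1
    calc N₁ * (permGL v * L * permGL v⁻¹) * permGL v * U
        = N₁ * permGL v * (L * (permGL v⁻¹ * permGL v) * U) := by simp only [mul_assoc]
      _ = N₁ * (permGL v * permGL v⁻¹) * (X * permGL v) := by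
        rw [hv, mul_one, ← hLU, hA]
        simp only [mul_assoc]
      _ = N₂ * permGL v := by
        rw [permGL_inv, mul_inv_cancel, mul_one, hXdef, mul_assoc, mul_inv_cancel_left]
  · rw [← permGL_smul_coordFlag, mul_smul, mul_smul, smul_smul (permGL v⁻¹), hv, one_smul, mul_smul]
    congr 2
    exact smul_antFlag_of_lower hL.isLowerTriangular

/-- The stabilisers of two opposite coordinate flags meet in the diagonal matrices, and a
unitriangular diagonal matrix is the identity. -/
theorem IsUnitLower.eq_of_smul_eq {N N' : GeneralLinearGroup (Fin k) ℂ} (h : IsUnitLower N)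
    (h' : IsUnitLower N') {v : Equiv.Perm (Fin k)} (h1 : N • coordFlag v = N' • coordFlag v)
    (h2 : N • coordFlag (v * longest k) = N' • coordFlag (v * longest k)) : N = N' := by
  rw [← inv_smul_eq_iff, smul_smul, smul_coordFlag_eq_self_iff] at h1 h2
  rw [eq_comm, ← inv_mul_eq_one]
  have hd := h'.inv.mul h
  ext i j
  rcases lt_trichotomy (v⁻¹ i) (v⁻¹ j) with hlt | heq | hlt
  · rw [h2 i j (by
      rw [_root_.mul_inv_rev, longest_inv]
      exact Fin.rev_lt_rev.mpr hlt), Units.val_one,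
      Matrix.one_apply_ne (by rintro rfl; exact lt_irrefl _ hlt)]
  · rw [v⁻¹.injective heq, hd.2, Units.val_one, Matrix.one_apply_eq]
  · rw [h1 i j hlt, Units.val_one, Matrix.one_apply_ne (by rintro rfl; exact lt_irrefl _ hlt)]

theorem IsUnitLower.eq_of_flagOf_eq {N N' : GeneralLinearGroup (Fin k) ℂ} (h : IsUnitLower N)
    (h' : IsUnitLower N') (hN : flagOf N = flagOf N') : N = N' := by
  refine h.eq_of_smul_eq h' (v := 1) ?_ ?_
  · change N • stdFlag k = N' • stdFlag k
    rw [← flagOf_eq_smul, ← flagOf_eq_smul, hN]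
  · rw [one_mul]
    change N • antFlag k = N' • antFlag k
    rw [smul_antFlag_of_lower h.isLowerTriangular, smul_antFlag_of_lower h'.isLowerTriangular]

theorem isLocallyRationalGL_of_flagOf {ι : Type} {P : Set (ι → GeneralLinearGroup (Fin k) ℂ)}
    {L p : (ι → GeneralLinearGroup (Fin k) ℂ) → GeneralLinearGroup (Fin k) ℂ}
    (g : GeneralLinearGroup (Fin k) ℂ) (hp : IsLocallyRationalGL P p)
    (hL : ∀ m ∈ P, IsUnitLower (L m)) (h : ∀ m ∈ P, flagOf (p m) = flagOf (g * L m)) :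
    IsLocallyRationalGL P L := fun i j => by
  have hreg := (IsLocallyRationalGL.const g⁻¹).mul hp
  refine ((hreg.cornerMinor i j).div (hreg.cornerMinor j j) fun m hm => ?_).congr fun m hm => ?_
  · exact exists_unitLower_iff_cornerMinor.mp ⟨L m, hL m hm, h m hm⟩ j
  · exact unitLower_apply (hL m hm) (h m hm) i j

/-- A matrix that translates two opposite coordinate flags is, up to a diagonal matrix, the lower
factor in the LU decomposition of a matrix between the two flags. -/
theorem IsUnitLower.exists_lower_factor {N p q : GeneralLinearGroup (Fin k) ℂ} (hN : IsUnitLower N)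
    {v : Equiv.Perm (Fin k)} (hp : flagOf p = N • coordFlag v)
    (hq : flagOf q = N • coordFlag (v * longest k)) :
    ∃ L : GeneralLinearGroup (Fin k) ℂ, IsUnitLower L ∧
      flagOf ((q * permGL (longest k))⁻¹ * p) = flagOf (1 * L) ∧
      (∀ j, (q * permGL (longest k) * L * permGL v⁻¹).val j j ≠ 0) ∧
      ∀ i j, N.val i j = (q * permGL (longest k) * L * permGL v⁻¹).val i j /
        (q * permGL (longest k) * L * permGL v⁻¹).val j j := by
  rw [coordFlag, smul_flagOf] at hp hq
  obtain ⟨U, hU, rfl⟩ := flagOf_eq_mul_upper hp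
  obtain ⟨B, hB, rfl⟩ := flagOf_eq_mul_upper hq
  set W := permGL (longest k) with hW
  have hWW : W * W = 1 := permGL_longest_mul_self
  have hC : (W * B * W).val.IsLowerTriangular := isLowerTriangular_longest_conj.mpr hB
  set C := W * B * W with hCdef
  have hq' : N * permGL (v * longest k) * B * W = N * permGL v * C := by
    rw [permGL_mul, hCdef]
    simp only [mul_assoc]
    rfl
  rw [hq']
  obtain ⟨L, hL, hCL⟩ := exists_unitLower_of_cornerMinor
    (cornerMinor_lower_ne_zero (blockTriangular_inv hC))
  obtain ⟨D, hD, hCD⟩ := flagOf_eq_mul_upper hCL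
  -- `D` is upper and lower triangular, hence diagonal. So `C * L` is diagonal, and `N` arises by
  -- normalising the columns of a product computed from `p` and `q`.
  have hD' : D.val.IsLowerTriangular := by
    rw [show D = L⁻¹ * C⁻¹ by rw [hCD, inv_mul_cancel_left]]
    exact blockTriangular_mul (blockTriangular_inv hL.isLowerTriangular) (blockTriangular_inv hC)
  have hDinv : D⁻¹ = C * L := by
    rw [inv_eq_iff_eq_inv, _root_.mul_inv_rev, hCD, inv_mul_cancel_left]
  have hE (i j : Fin k) (hij : i ≠ j) : (permGL v * D⁻¹ * permGL v⁻¹).val i j = 0 := by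
    rw [permGL_conj_apply]
    rcases lt_or_gt_of_ne (v⁻¹.injective.ne hij) with h | h
    · exact blockTriangular_inv hD' h
    · exact blockTriangular_inv hD h
  have hprod : N * permGL v * C * L * permGL v⁻¹ = N * (permGL v * D⁻¹ * permGL v⁻¹) := by
    rw [hDinv]
    simp only [mul_assoc]
  set E := permGL v * D⁻¹ * permGL v⁻¹ with hEdef
  have hEd (j : Fin k) : E.val j j ≠ 0 := by
    have := det_ne_zero E
    rw [det_of_isUpperTriangular fun i j hij => hE i j (ne_of_gt hij),
      Finset.prod_ne_zero_iff] at this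
    exact this j (Finset.mem_univ _)
  have hNE (i j : Fin k) : (N * E).val i j = N.val i j * E.val j j := by
    rw [Units.val_mul, Matrix.mul_apply]
    exact Finset.sum_eq_single j (fun l _ hl => by rw [hE l j hl, mul_zero]) (by simp)
  refine ⟨L, hL, ?_, fun j => ?_, fun i j => ?_⟩
  · rw [one_mul, ← hCL, ← mul_assoc, flagOf_mul_upper hU]
    congr 1
    group
  · rw [hprod, hNE, hN.2, one_mul]
    exact hEd j
  · rw [hprod, hNE, hNE, hN.2, one_mul, mul_div_cancel_right₀ _ (hEd j)]

/-- Makes the inverse of splicing algebraic: `N` is recovered rationally from its action on two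
opposite flags. -/
theorem isLocallyRationalGL_of_opposite {ι : Type} {P : Set (ι → GeneralLinearGroup (Fin k) ℂ)}
    {N p q : (ι → GeneralLinearGroup (Fin k) ℂ) → GeneralLinearGroup (Fin k) ℂ}
    (v : Equiv.Perm (Fin k)) (hp : IsLocallyRationalGL P p) (hq : IsLocallyRationalGL P q)
    (hN : ∀ m ∈ P, IsUnitLower (N m)) (hpN : ∀ m ∈ P, flagOf (p m) = N m • coordFlag v)
    (hqN : ∀ m ∈ P, flagOf (q m) = N m • coordFlag (v * longest k)) :
    IsLocallyRationalGL P N := by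
  have hex (m : ι → GeneralLinearGroup (Fin k) ℂ) :
      ∃ L : GeneralLinearGroup (Fin k) ℂ, m ∈ P → IsUnitLower L ∧
      flagOf ((q m * permGL (longest k))⁻¹ * p m) = flagOf (1 * L) ∧
      (∀ j, (q m * permGL (longest k) * L * permGL v⁻¹).val j j ≠ 0) ∧
      ∀ i j, (N m).val i j = (q m * permGL (longest k) * L * permGL v⁻¹).val i j /
        (q m * permGL (longest k) * L * permGL v⁻¹).val j j := by
    by_cases hm : m ∈ P
    · obtain ⟨L, hL⟩ := (hN m hm).exists_lower_factor (hpN m hm) (hqN m hm)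
      exact ⟨L, fun _ => hL⟩
    · exact ⟨1, fun h => absurd h hm⟩
  choose L hL using hex
  have hqW := hq.mul (.const (permGL (longest k)))
  have hLreg : IsLocallyRationalGL P L :=
    isLocallyRationalGL_of_flagOf 1 (hqW.inv.mul hp) (fun m hm => (hL m hm).1)
      fun m hm => (hL m hm).2.1
  have hreg := (hqW.mul hLreg).mul (.const (permGL v⁻¹))
  exact fun i j => ((hreg i j).div (hreg j j) fun m hm => (hL m hm).2.2.1 j).congr
    fun m hm => (hL m hm).2.2.2 i j

end OppositeFlags

/-! ### Splicing of sequences of flags -/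

section Splicing

variable {k : ℕ}

/-- The sequence of flags is a point of the braid variety of the word. -/
def IsBraidPoint (β : List (Fin (k - 1))) (f : ℕ → CompleteFlag k) : Prop :=
  f 0 = stdFlag k ∧ f β.length = antFlag k ∧ IsPath β f

/-- The matrix `g₂` of the splicing map, in terms of `N = L⁻¹`. -/
def spliceGL (w : Equiv.Perm (Fin k)) (N : GeneralLinearGroup (Fin k) ℂ) :
    GeneralLinearGroup (Fin k) ℂ :=
  N * permGL (longest k * w⁻¹ * longest k)

theorem permGL_longest_smul_antFlag : permGL (longest k) • antFlag k = stdFlag k := by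
  rw [antFlag, permGL_smul_coordFlag, longest_mul_longest, stdFlag]

theorem permGL_longest_smul_stdFlag : permGL (longest k) • stdFlag k = antFlag k := by
  rw [stdFlag, permGL_smul_coordFlag, mul_one, antFlag]

theorem longest_mul_cancel (x : Equiv.Perm (Fin k)) : longest k * (longest k * x) = x := by
  rw [← mul_assoc, longest_mul_longest, one_mul]

theorem permGL_longest_smul_smul (F : CompleteFlag k) :
    permGL (longest k) • permGL (longest k) • F = F := by
  rw [smul_smul, permGL_longest_mul_self, one_smul]

theorem spliceGL_smul_coordFlag (w x : Equiv.Perm (Fin k)) (N : GeneralLinearGroup (Fin k) ℂ) :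
    spliceGL w N • coordFlag (longest k * x) = N • coordFlag (longest k * w⁻¹ * x) := by
  rw [spliceGL, mul_smul, permGL_smul_coordFlag, mul_assoc _ (longest k), longest_mul_cancel]

theorem conj_smul_coordFlag (N : GeneralLinearGroup (Fin k) ℂ) (x : Equiv.Perm (Fin k)) :
    (permGL (longest k) * N * permGL (longest k)) • coordFlag x =
      permGL (longest k) • N • coordFlag (longest k * x) := by
  rw [mul_smul, mul_smul, permGL_smul_coordFlag]

/-- The two sequences `G₁` and `G₂` are obtained by splicing the sequence `f`, where `N = L⁻¹`. -/
structure IsSplice (β₁ β₂ a b : List (Fin (k - 1))) (w : Equiv.Perm (Fin k))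
    (N : GeneralLinearGroup (Fin k) ℂ) (f G₁ G₂ : ℕ → CompleteFlag k) : Prop where
  unitLower : IsUnitLower N
  smul_mid : spliceGL w N • f β₁.length = stdFlag k
  fst_left : ∀ j ≤ b.length,
    G₁ j = (permGL (longest k) * N * permGL (longest k)) • coordFlag (wordPerm (b.take j))
  fst_right : ∀ i ≤ β₁.length, G₁ (b.length + i) = permGL (longest k) • spliceGL w N • f i
  snd_left : ∀ j ≤ β₂.length, G₂ j = spliceGL w N • f (β₁.length + j)
  snd_right : ∀ n ≤ a.length,
    G₂ (β₂.length + n) = N • coordFlag (longest k * w⁻¹ * wordPerm (a.take n))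

variable {β₁ β₂ a b : List (Fin (k - 1))} {w : Equiv.Perm (Fin k)}
  {N N' : GeneralLinearGroup (Fin k) ℂ} {f f' G₁ G₂ G₁' G₂' : ℕ → CompleteFlag k}

theorem IsUnitLower.conj_isUpperTriangular (hN : IsUnitLower N) :
    (permGL (longest k) * N * permGL (longest k)).val.IsUpperTriangular :=
  isUpperTriangular_longest_conj.mpr hN.isLowerTriangular

/-- Two formulas prescribe each junction flag. They agree because `f` starts at the standard flag
and ends at the antistandard one. -/
theorem exists_isSplice (hb : wordPerm b = w⁻¹ * longest k) (hf : IsBraidPoint (β₁ ++ β₂) f)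
    (hN : IsUnitLower N) (hmid : spliceGL w N • f β₁.length = stdFlag k) :
    ∃ G₁ G₂, IsSplice β₁ β₂ a b w N f G₁ G₂ := by
  refine ⟨fun j => if j ≤ b.length then
      (permGL (longest k) * N * permGL (longest k)) • coordFlag (wordPerm (b.take j))
    else permGL (longest k) • spliceGL w N • f (j - b.length),
    fun j => if j ≤ β₂.length then spliceGL w N • f (β₁.length + j)
    else N • coordFlag (longest k * w⁻¹ * wordPerm (a.take (j - β₂.length))),
    hN, hmid, fun j hj => if_pos hj, fun i _ => ?_, fun j hj => if_pos hj, fun n _ => ?_⟩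
  · split_ifs with h
    · obtain rfl : i = 0 := by omega
      rw [add_zero, List.take_length, hb, conj_smul_coordFlag, hf.1, stdFlag,
        ← longest_mul_longest, spliceGL_smul_coordFlag, mul_assoc]
    · rw [Nat.add_sub_cancel_left]
  · split_ifs with h
    · obtain rfl : n = 0 := by omega
      have := hf.2.1
      rw [List.length_append] at this
      rw [add_zero, List.take_zero, wordPerm_nil, this, antFlag, ← spliceGL_smul_coordFlag, mul_one]
    · rw [Nat.add_sub_cancel_left]

theorem IsSplice.isBraidPoint (h : IsSplice β₁ β₂ a b w N f G₁ G₂) (ha : wordPerm a = w)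
    (hf : IsBraidPoint (β₁ ++ β₂) f) :
    IsBraidPoint (b ++ β₁) G₁ ∧ IsBraidPoint (β₂ ++ a) G₂ := by
  obtain ⟨hp1, hp2⟩ := isPath_append.mp hf.2.2
  refine ⟨⟨?_, ?_, isPath_append.mpr ⟨?_, ?_⟩⟩, ⟨?_, ?_, isPath_append.mpr ⟨?_, ?_⟩⟩⟩
  · rw [h.fst_left 0 (Nat.zero_le _), List.take_zero, wordPerm_nil]
    exact smul_stdFlag_of_upper h.unitLower.conj_isUpperTriangular
  · rw [List.length_append, h.fst_right _ le_rfl, h.smul_mid, permGL_longest_smul_stdFlag]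
  · refine ((isPath_coordFlag 1 b).smul (permGL (longest k) * N * permGL (longest k))).congr fun j hj => ?_
    rw [h.fst_left j hj, one_mul]
  · exact ((hp1.smul _).smul _).congr fun i hi => h.fst_right i hi
  · rw [h.snd_left 0 (Nat.zero_le _), add_zero, h.smul_mid]
  · rw [List.length_append, h.snd_right _ le_rfl, List.take_length, ha, inv_mul_cancel_right]
    exact smul_antFlag_of_lower h.unitLower.isLowerTriangular
  · exact (hp2.smul _).congr fun j hj => h.snd_left j hj
  · exact ((isPath_coordFlag _ a).smul _).congr fun n hn => h.snd_right n hn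

theorem IsSplice.isBraidPoint_of_factors (h : IsSplice β₁ β₂ a b w N f G₁ G₂)
    (hb : wordPerm b = w⁻¹ * longest k) (h₁ : IsBraidPoint (b ++ β₁) G₁)
    (h₂ : IsBraidPoint (β₂ ++ a) G₂) : IsBraidPoint (β₁ ++ β₂) f := by
  refine ⟨?_, ?_, isPath_append.mpr ⟨?_, ?_⟩⟩
  · have := (h.fst_right 0 (Nat.zero_le _)).symm
    rw [add_zero, h.fst_left _ le_rfl, List.take_length, hb, conj_smul_coordFlag, ← mul_assoc,
      ← spliceGL_smul_coordFlag, longest_mul_longest] at this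
    exact smul_left_cancel _ (smul_left_cancel _ this)
  · have := (h.snd_left _ le_rfl).symm
    rw [← add_zero β₂.length, h.snd_right 0 (Nat.zero_le _), List.take_zero, wordPerm_nil,
      ← spliceGL_smul_coordFlag, mul_one, add_zero] at this
    rw [List.length_append]
    exact smul_left_cancel _ this
  · have := (isPath_append.mp h₁.2.2).2
    refine ((this.smul (permGL (longest k))⁻¹).smul (spliceGL w N)⁻¹).congr fun i hi => ?_
    rw [h.fst_right i hi, inv_smul_smul, inv_smul_smul]
  · have := (isPath_append.mp h₂.2.2).1
    refine (this.smul (spliceGL w N)⁻¹).congr fun i hi => ?_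
    rw [h.snd_left i hi, inv_smul_smul]

/-- Together with `IsSplice.smul_coordFlag_snd`, this exhibits the junction flags as `N`-translates
of opposite coordinate flags, so the factors determine `N`. -/
theorem IsSplice.smul_coordFlag_fst (h : IsSplice β₁ β₂ a b w N f G₁ G₂)
    (hb : wordPerm b = w⁻¹ * longest k) :
    N • coordFlag (longest k * w⁻¹ * longest k) = permGL (longest k) • G₁ b.length := by
  rw [h.fst_left _ le_rfl, List.take_length, hb, conj_smul_coordFlag, permGL_longest_smul_smul,
    mul_assoc]

theorem IsSplice.smul_coordFlag_snd (h : IsSplice β₁ β₂ a b w N f G₁ G₂) :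
    N • coordFlag (longest k * w⁻¹) = G₂ β₂.length := by
  have := (h.snd_right 0 (Nat.zero_le _)).symm
  rwa [List.take_zero, wordPerm_nil, mul_one, add_zero] at this

theorem IsSplice.eq_of_factors (h : IsSplice β₁ β₂ a b w N f G₁ G₂)
    (h' : IsSplice β₁ β₂ a b w N' f' G₁ G₂) (hb : wordPerm b = w⁻¹ * longest k) :
    ∀ i ≤ (β₁ ++ β₂).length, f i = f' i := by
  obtain rfl : N = N' := h.unitLower.eq_of_smul_eq h'.unitLower
    (h.smul_coordFlag_snd.trans h'.smul_coordFlag_snd.symm)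
    ((h.smul_coordFlag_fst hb).trans (h'.smul_coordFlag_fst hb).symm)
  intro i hi
  rcases le_total i β₁.length with hi1 | hi1
  · have := (h.fst_right i hi1).symm.trans (h'.fst_right i hi1)
    exact smul_left_cancel _ (smul_left_cancel _ this)
  · obtain ⟨j, rfl⟩ := Nat.exists_eq_add_of_le hi1
    rw [List.length_append] at hi
    have := (h.snd_left j (by omega)).symm.trans (h'.snd_left j (by omega))
    exact smul_left_cancel _ this

/-- The flag at the splicing position determines the matrix of the splicing. -/
theorem spliceGL_smul_eq_stdFlag_iff {F : CompleteFlag k} :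
    spliceGL w N • F = stdFlag k ↔ F = flagOf (permGL (longest k * w * longest k) * N⁻¹) := by
  have : (spliceGL w N)⁻¹ = permGL (longest k * w * longest k) * N⁻¹ := by
    rw [spliceGL, _root_.mul_inv_rev, ← permGL_inv, _root_.mul_inv_rev, _root_.mul_inv_rev, inv_inv,
      longest_inv, mul_assoc]
  rw [← eq_inv_smul_iff, this, ← flagOf_eq_smul]

theorem IsSplice.eq_matrix (h : IsSplice β₁ β₂ a b w N f G₁ G₂)
    (h' : IsSplice β₁ β₂ a b w N' f G₁' G₂') : N = N' := by
  have e := (spliceGL_smul_eq_stdFlag_iff.mp h.smul_mid).symm.trans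
    (spliceGL_smul_eq_stdFlag_iff.mp h'.smul_mid)
  rw [← smul_flagOf, ← smul_flagOf] at e
  exact inv_injective (h.unitLower.inv.eq_of_flagOf_eq h'.unitLower.inv (smul_left_cancel _ e))

theorem IsSplice.factors_eq (h : IsSplice β₁ β₂ a b w N f G₁ G₂)
    (h' : IsSplice β₁ β₂ a b w N' f G₁' G₂') :
    (∀ j ≤ (b ++ β₁).length, G₁ j = G₁' j) ∧ ∀ j ≤ (β₂ ++ a).length, G₂ j = G₂' j := by
  obtain rfl := h.eq_matrix h'
  constructor
  · intro j hj
    rcases le_total j b.length with hj1 | hj1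
    · rw [h.fst_left j hj1, h'.fst_left j hj1]
    · obtain ⟨i, rfl⟩ := Nat.exists_eq_add_of_le hj1
      rw [List.length_append] at hj
      rw [h.fst_right i (by omega), h'.fst_right i (by omega)]
  · intro j hj
    rcases le_total j β₂.length with hj1 | hj1
    · rw [h.snd_left j hj1, h'.snd_left j hj1]
    · obtain ⟨i, rfl⟩ := Nat.exists_eq_add_of_le hj1
      rw [List.length_append] at hj
      rw [h.snd_right i (by omega), h'.snd_right i (by omega)]

/-- Every pair of points of the factors is obtained by splicing. -/
theorem exists_isSplice_of_factors (ha : IsReducedWord a w)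
    (hb : IsReducedWord b (w⁻¹ * longest k)) (h₁ : IsBraidPoint (b ++ β₁) G₁)
    (h₂ : IsBraidPoint (β₂ ++ a) G₂) : ∃ N f, IsSplice β₁ β₂ a b w N f G₁ G₂ := by
  obtain ⟨U₁, hU₁, hG₁⟩ :=
    hb.isAscending.exists_unitUpper h₁.1 (isPath_append.mp h₁.2.2).1 le_rfl
  have hend : G₂ (β₂.length + a.length) = antFlag k := by rw [← List.length_append, h₂.2.1]
  -- Read backwards and turned by `w₀`, the tail of `G₂` along `a` starts at the standard flag and
  -- follows a reduced word of `w⁻¹`.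
  have hrev := ((isPath_append.mp h₂.2.2).2.smul (permGL (longest k))).reverse
  obtain ⟨U₂, hU₂, hG₂⟩ := ha.reverse.isAscending.exists_unitUpper
    (by rw [Nat.sub_zero, hend, permGL_longest_smul_antFlag]) hrev le_rfl
  rw [List.length_reverse] at hG₂
  set W := permGL (longest k) with hW
  have hG₁' : W • G₁ b.length = (W * U₁ * W) • coordFlag (longest k * w⁻¹ * longest k) := by
    rw [hG₁ _ le_rfl, List.take_length, hb.1, conj_smul_coordFlag, mul_assoc, longest_mul_cancel]
  have hG₂' (n : ℕ) (hn : n ≤ a.length) : G₂ (β₂.length + n) =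
      (W * U₂ * W) • coordFlag (longest k * wordPerm (a.reverse.take (a.length - n))) := by
    have := hG₂ (a.length - n) (Nat.sub_le _ _)
    rw [Nat.sub_sub_self hn] at this
    rw [conj_smul_coordFlag, longest_mul_cancel, ← this, permGL_longest_smul_smul]
  obtain ⟨N, hN, hN₂, hN₁⟩ := exists_common_unitLower hU₁ hU₂ (longest k * w⁻¹)
  have hstart : G₂ 0 = stdFlag k := h₂.1
  have hend₁ : G₁ (b.length + β₁.length) = antFlag k := by rw [← List.length_append, h₁.2.1]
  -- Undo `g₁ = w₀g₂` before the splicing position and `g₂` after it. At that position both give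
  -- `g₂⁻¹F^std`, as `G₁` ends at the antistandard flag and `G₂` starts at the standard one.
  refine ⟨N, fun i => if i ≤ β₁.length then (spliceGL w N)⁻¹ • W • G₁ (b.length + i)
    else (spliceGL w N)⁻¹ • G₂ (i - β₁.length), hN, ?_, fun j hj => ?_, fun i hi => ?_,
    fun j _ => ?_, fun n hn => ?_⟩
  · rw [if_pos le_rfl, smul_inv_smul, hend₁, permGL_longest_smul_antFlag]
  · rw [hG₁ j hj]
    refine hb.isAscending.smul_coordFlag_eq hU₁.isUpperTriangular hN.conj_isUpperTriangular ?_ hj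
    rw [hb.1, conj_smul_coordFlag, ← mul_assoc, hN₁, conj_smul_coordFlag, mul_assoc (longest k),
      longest_mul_cancel, permGL_longest_smul_smul]
  · rw [if_pos hi, smul_inv_smul, permGL_longest_smul_smul]
  · split_ifs with h
    · obtain rfl : j = 0 := by omega
      rw [add_zero, hend₁, permGL_longest_smul_antFlag, smul_inv_smul, hstart]
    · rw [Nat.add_sub_cancel_left, smul_inv_smul]
  · rw [hG₂' n hn]
    have hword : longest k * w⁻¹ * wordPerm (a.take n) =
        longest k * wordPerm (a.reverse.take (a.length - n)) := by
      rw [List.take_reverse, Nat.sub_sub_self hn, wordPerm_reverse, mul_assoc]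
      congr 1
      rw [eq_inv_iff_mul_eq_one, mul_assoc, ← wordPerm_append, List.take_append_drop, ha.1,
        inv_mul_cancel]
    rw [hword]
    -- `N` was chosen to match at the junction flag only; the end of the reversed path determines
    -- the rest.
    have := ha.reverse.isAscending.smul_coordFlag_eq (U := U₂) (V := W * N * W)
      hU₂.isUpperTriangular hN.conj_isUpperTriangular ?_ (j := a.length - n)
      (by rw [List.length_reverse]; omega)
    · rw [conj_smul_coordFlag, longest_mul_cancel, this, conj_smul_coordFlag,
        permGL_longest_smul_smul]
    · rw [wordPerm_reverse, ha.1, conj_smul_coordFlag, hN₂, conj_smul_coordFlag, longest_mul_cancel,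
        permGL_longest_smul_smul]

end Splicing

/-! ### The splicing isomorphism -/

section Isomorphism

variable {k : ℕ}

/-- The extension of a finite sequence of flags, constant from the last flag on. -/
def extendFlags {n : ℕ} (F : Fin (n + 1) → CompleteFlag k) (j : ℕ) : CompleteFlag k :=
  F ⟨min j n, by omega⟩

theorem extendFlags_of_le {n : ℕ} (F : Fin (n + 1) → CompleteFlag k) {j : ℕ} (hj : j ≤ n) :
    extendFlags F j = F ⟨j, by omega⟩ := by
  simp only [extendFlags, min_eq_left hj]

theorem extendFlags_val {n : ℕ} (F : Fin (n + 1) → CompleteFlag k) (j : Fin (n + 1)) :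
    extendFlags F j = F j :=
  extendFlags_of_le F (Nat.lt_succ_iff.mp j.isLt)

theorem eq_of_extendFlags {n : ℕ} {F F' : Fin (n + 1) → CompleteFlag k}
    (h : ∀ j ≤ n, extendFlags F j = extendFlags F' j) : F = F' := by
  funext j
  rw [← extendFlags_val F, ← extendFlags_val F', h j (Nat.lt_succ_iff.mp j.isLt)]

theorem mem_braidVariety_iff {β : List (Fin (k - 1))}
    {F : Fin (β.length + 1) → CompleteFlag k} :
    F ∈ braidVariety β ↔ IsBraidPoint β (extendFlags F) := by
  refine and_congr ?_ (and_congr ?_ ?_)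
  · rw [extendFlags_of_le F (Nat.zero_le _)]
    rfl
  · rw [extendFlags_of_le F le_rfl]
    rfl
  · refine ⟨fun h j hj => ?_, fun h j => ?_⟩
    · rw [extendFlags_of_le F hj.le, extendFlags_of_le F hj]
      exact h ⟨j, hj⟩
    · have := h j j.isLt
      rwa [extendFlags_of_le F j.isLt.le, extendFlags_of_le F j.isLt] at this

theorem IsSplice.congr {β₁ β₂ a b : List (Fin (k - 1))} {w : Equiv.Perm (Fin k)}
    {N : GeneralLinearGroup (Fin k) ℂ} {f f' G₁ G₁' G₂ G₂' : ℕ → CompleteFlag k}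
    (h : IsSplice β₁ β₂ a b w N f G₁ G₂) (hf : ∀ j ≤ (β₁ ++ β₂).length, f' j = f j)
    (h₁ : ∀ j ≤ (b ++ β₁).length, G₁' j = G₁ j) (h₂ : ∀ j ≤ (β₂ ++ a).length, G₂' j = G₂ j) :
    IsSplice β₁ β₂ a b w N f' G₁' G₂' := by
  simp only [List.length_append] at hf h₁ h₂
  refine ⟨h.unitLower, ?_, fun j hj => ?_, fun i hi => ?_, fun j hj => ?_, fun n hn => ?_⟩
  · rw [hf _ (by omega), h.smul_mid]
  · rw [h₁ _ (by omega), h.fst_left j hj]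
  · rw [h₁ _ (by omega), hf _ (by omega), h.fst_right i hi]
  · rw [h₂ _ (by omega), hf _ (by omega), h.snd_left j hj]
  · rw [h₂ _ (by omega), h.snd_right n hn]

theorem extendFlags_restrict {n : ℕ} (g : ℕ → CompleteFlag k) {j : ℕ} (hj : j ≤ n) :
    extendFlags (fun i : Fin (n + 1) => g i) j = g j :=
  extendFlags_of_le _ hj

variable {β : List (Fin (k - 1))} {r₁ : Fin (β.length + 1)} {w : Equiv.Perm (Fin k)}
  {a b : List (Fin (k - 1))}

/-- The pair `G` is obtained from the tuple `F` by splicing, where `N = L⁻¹`. -/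
def IsSpliceTuple (β : List (Fin (k - 1))) (r₁ : Fin (β.length + 1)) (w : Equiv.Perm (Fin k))
    (a b : List (Fin (k - 1))) (N : GeneralLinearGroup (Fin k) ℂ)
    (F : Fin (β.length + 1) → CompleteFlag k)
    (G : Fin ((b ++ β.take r₁).length + 1) ⊕ Fin ((β.drop r₁ ++ a).length + 1) →
      CompleteFlag k) : Prop :=
  IsSplice (β.take r₁) (β.drop r₁) a b w N (extendFlags F) (extendFlags (G ∘ Sum.inl))
    (extendFlags (G ∘ Sum.inr))

variable {N N' : GeneralLinearGroup (Fin k) ℂ} {F F' : Fin (β.length + 1) → CompleteFlag k}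
  {G G' : Fin ((b ++ β.take r₁).length + 1) ⊕ Fin ((β.drop r₁ ++ a).length + 1) → CompleteFlag k}

theorem mem_braidVariety_iff_append : F ∈ braidVariety β ↔
    IsBraidPoint (β.take r₁ ++ β.drop r₁) (extendFlags F) := by
  rw [mem_braidVariety_iff, List.take_append_drop]

theorem length_take_val (r₁ : Fin (β.length + 1)) : (β.take r₁).length = r₁ := by
  rw [List.length_take]
  omega

theorem length_drop_val (r₁ : Fin (β.length + 1)) : (β.drop r₁).length = β.length - r₁ :=
  List.length_drop

theorem exists_isSpliceTuple (ha : IsReducedWord a w) (hb : IsReducedWord b (w⁻¹ * longest k))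
    (hF : F ∈ splicingLocus β r₁ w) :
    ∃ N, ∃ G ∈ prodVariety (braidVariety (b ++ β.take r₁)) (braidVariety (β.drop r₁ ++ a)),
      IsSpliceTuple β r₁ w a b N F G := by
  obtain ⟨L, hL, hFL⟩ := transverse_iff_exists_unitLower.mp hF.2
  have hF' := (mem_braidVariety_iff_append (r₁ := r₁)).mp hF.1
  obtain ⟨G₁, G₂, h⟩ := exists_isSplice (a := a) (N := L⁻¹) hb.1 hF' hL.inv (by
    rw [length_take_val, extendFlags_val, spliceGL_smul_eq_stdFlag_iff, inv_inv, hFL])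
  obtain ⟨h1, h2⟩ := h.isBraidPoint ha.1 hF'
  have hG : IsSpliceTuple β r₁ w a b L⁻¹ F (Sum.elim (fun j => G₁ j) fun j => G₂ j) :=
    h.congr (fun _ _ => rfl) (fun j hj => extendFlags_restrict G₁ hj)
      fun j hj => extendFlags_restrict G₂ hj
  obtain ⟨h1, h2⟩ := hG.isBraidPoint ha.1 hF'
  exact ⟨L⁻¹, _, ⟨mem_braidVariety_iff.mpr h1, mem_braidVariety_iff.mpr h2⟩, hG⟩

theorem exists_isSpliceTuple_of_factors (ha : IsReducedWord a w)
    (hb : IsReducedWord b (w⁻¹ * longest k))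
    (hG : G ∈ prodVariety (braidVariety (b ++ β.take r₁)) (braidVariety (β.drop r₁ ++ a))) :
    ∃ N, ∃ F ∈ splicingLocus β r₁ w, IsSpliceTuple β r₁ w a b N F G := by
  have h₁ := mem_braidVariety_iff.mp hG.1
  have h₂ := mem_braidVariety_iff.mp hG.2
  obtain ⟨N, f, h⟩ := exists_isSplice_of_factors ha hb h₁ h₂
  have hF : IsSpliceTuple β r₁ w a b N (fun i => f i) G :=
    h.congr (fun j hj => extendFlags_restrict f (by rwa [List.take_append_drop] at hj))
      (fun _ _ => rfl) fun _ _ => rfl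
  refine ⟨N, _, ⟨?_, ?_⟩, hF⟩
  · rw [mem_braidVariety_iff_append (r₁ := r₁)]
    exact hF.isBraidPoint_of_factors hb.1 h₁ h₂
  · have := spliceGL_smul_eq_stdFlag_iff.mp hF.smul_mid
    rw [length_take_val, extendFlags_val] at this
    exact transverse_iff_exists_unitLower.mpr ⟨N⁻¹, h.unitLower.inv, this⟩

theorem IsSpliceTuple.source_eq (h : IsSpliceTuple β r₁ w a b N F G)
    (h' : IsSpliceTuple β r₁ w a b N' F' G) (hb : IsReducedWord b (w⁻¹ * longest k)) : F = F' :=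
  eq_of_extendFlags fun j hj =>
    IsSplice.eq_of_factors h h' hb.1 j (by rwa [List.take_append_drop])

theorem IsSpliceTuple.target_eq (h : IsSpliceTuple β r₁ w a b N F G)
    (h' : IsSpliceTuple β r₁ w a b N' F G') : G = G' := by
  obtain ⟨h1, h2⟩ := IsSplice.factors_eq h h'
  funext c
  rcases c with j | j
  · exact congrFun (eq_of_extendFlags h1) j
  · exact congrFun (eq_of_extendFlags h2) j

theorem IsSpliceTuple.isSplicingOf (h : IsSpliceTuple β r₁ w a b N F G) :
    IsSplicingOf β r₁ w a b F G := by
  have hr := r₁.isLt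
  have hg : (permGL (longest k * w * longest k) * N⁻¹)⁻¹ = spliceGL w N := by
    rw [spliceGL, _root_.mul_inv_rev, ← permGL_inv, _root_.mul_inv_rev, _root_.mul_inv_rev, inv_inv,
      longest_inv, mul_assoc]
  refine ⟨N⁻¹, _, _, h.unitLower.inv, ?_, rfl, rfl, ?_, ?_, ?_, ?_⟩
  · rw [← spliceGL_smul_eq_stdFlag_iff, ← extendFlags_val F, ← length_take_val r₁]
    exact h.smul_mid
  · intro j hj
    have := h.fst_left j hj
    rw [extendFlags_val] at this
    rw [hg, mul_smul, mul_assoc (longest k), spliceGL_smul_coordFlag, mul_assoc (longest k),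
      inv_mul_cancel_left, ← conj_smul_coordFlag, ← this]
    rfl
  · intro j i hji
    have hj := j.isLt
    simp only [List.length_append, length_take_val] at hj
    have := h.fst_right i (by rw [length_take_val]; omega)
    rw [← hji, extendFlags_val, extendFlags_val] at this
    rw [hg, mul_smul, ← this]
    rfl
  · intro j i hij
    have hi := i.isLt
    have := h.snd_left j (by rw [length_drop_val]; omega)
    rw [length_take_val, ← hij, extendFlags_val, extendFlags_val] at this
    rw [hg, ← this]
    rfl
  · intro j n hjn
    have hj := j.isLt
    simp only [List.length_append, length_drop_val] at hj
    have := h.snd_right n (by omega)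
    rw [length_drop_val, show β.length - r₁ + n = j by omega, extendFlags_val] at this
    rw [hg, spliceGL_smul_coordFlag, ← this]
    rfl

theorem IsLocallyRationalGL.spliceGL {ι : Type} {P : Set (ι → GeneralLinearGroup (Fin k) ℂ)}
    {A : (ι → GeneralLinearGroup (Fin k) ℂ) → GeneralLinearGroup (Fin k) ℂ}
    (hA : IsLocallyRationalGL P A) (w : Equiv.Perm (Fin k)) :
    IsLocallyRationalGL P fun m => spliceGL w (A m) :=
  hA.mul (.const _)

theorem extendFlags_flagTuple {n : ℕ} (m : Fin (n + 1) → GeneralLinearGroup (Fin k) ℂ) (j : ℕ) :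
    extendFlags (flagTuple m) j = flagOf (m ⟨min j n, by omega⟩) := rfl

/-- The splicing map is a morphism. -/
theorem isMorphism_splice {φ : splicingLocus β r₁ w →
      prodVariety (braidVariety (b ++ β.take r₁)) (braidVariety (β.drop r₁ ++ a))}
    (hφ : ∀ F, ∃ N, IsSpliceTuple β r₁ w a b N F.val (φ F).val) : IsMorphism φ := by
  classical
  choose M hM using hφ
  set N : (Fin (β.length + 1) → GeneralLinearGroup (Fin k) ℂ) → GeneralLinearGroup (Fin k) ℂ :=
    fun m => if hm : flagTuple m ∈ splicingLocus β r₁ w then M ⟨_, hm⟩ else 1 with hN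
  have hNM (m) (hm : flagTuple m ∈ splicingLocus β r₁ w) : N m = M ⟨_, hm⟩ := dif_pos hm
  have hS (m) (hm : flagTuple m ∈ splicingLocus β r₁ w) :
      IsSpliceTuple β r₁ w a b (N m) (flagTuple m) (φ ⟨_, hm⟩).val := by
    rw [hNM m hm]
    exact hM _
  have hreg : IsLocallyRationalGL {m | flagTuple m ∈ splicingLocus β r₁ w} N := by
    -- `N⁻¹` is the unitriangular coordinate of the flag at `r₁` in its big cell.
    have : IsLocallyRationalGL {m | flagTuple m ∈ splicingLocus β r₁ w} fun m => (N m)⁻¹ := by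
      refine isLocallyRationalGL_of_flagOf (permGL (longest k * w * longest k)) (.entry r₁)
        (fun m hm => (hS m hm).unitLower.inv) fun m hm => ?_
      have := spliceGL_smul_eq_stdFlag_iff.mp (hS m hm).smul_mid
      rwa [length_take_val, extendFlags_val] at this
    exact this.inv.congr fun m _ => (inv_inv _).symm
  -- Each `min` only keeps the index in range; in its own branch it equals its first argument.
  refine isMorphism_of_lift (fun m => Sum.elim
    (fun j => if (j : ℕ) ≤ b.length then
        permGL (longest k) * N m * permGL (longest k) * permGL (wordPerm (b.take j))
      else permGL (longest k) * spliceGL w (N m) * m ⟨min (j - b.length) β.length, by omega⟩)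
    (fun j => if (j : ℕ) ≤ (β.drop r₁).length then
        spliceGL w (N m) * m ⟨min (r₁ + j) β.length, by omega⟩
      else N m * permGL (longest k * w⁻¹ * wordPerm (a.take (j - (β.drop r₁).length))))) ?_ ?_
  · rintro (j | j)
    · dsimp only [Sum.elim_inl]
      split_ifs
      · exact (((IsLocallyRationalGL.const _).mul hreg).mul (.const _)).mul (.const _)
      · exact ((IsLocallyRationalGL.const _).mul (hreg.spliceGL w)).mul (.entry _)
    · dsimp only [Sum.elim_inr]
      split_ifs
      · exact (hreg.spliceGL w).mul (.entry _)
      · exact hreg.mul (.const _)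
  · intro m hm
    have h := hS m hm
    funext c
    rcases c with j | j
    · change _ = flagOf (ite _ _ _)
      have hj := j.isLt
      simp only [List.length_append] at hj
      have hφj := extendFlags_val ((φ ⟨_, hm⟩).val ∘ Sum.inl) j
      rw [Function.comp_apply] at hφj
      rw [← hφj]
      split_ifs with hjb
      · rw [h.fst_left j hjb, coordFlag, smul_flagOf]
      · have := h.fst_right (j - b.length) (by omega)
        rw [Nat.add_sub_of_le (not_le.mp hjb).le] at this
        rw [this, extendFlags_flagTuple, smul_flagOf, smul_flagOf, mul_assoc]
    · change _ = flagOf (ite _ _ _)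
      have hj := j.isLt
      simp only [List.length_append] at hj
      have hφj := extendFlags_val ((φ ⟨_, hm⟩).val ∘ Sum.inr) j
      rw [Function.comp_apply] at hφj
      rw [← hφj]
      split_ifs with hjb
      · rw [h.snd_left j hjb, length_take_val, extendFlags_flagTuple, smul_flagOf]
      · have := h.snd_right (j - (β.drop r₁).length) (by omega)
        rw [Nat.add_sub_of_le (not_le.mp hjb).le] at this
        rw [this, coordFlag, smul_flagOf]

/-- The inverse of the splicing map is a morphism. -/
theorem isMorphism_unsplice (hb : IsReducedWord b (w⁻¹ * longest k))
    {ψ : prodVariety (braidVariety (b ++ β.take r₁)) (braidVariety (β.drop r₁ ++ a)) →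
      splicingLocus β r₁ w}
    (hψ : ∀ G, ∃ N, IsSpliceTuple β r₁ w a b N (ψ G).val G.val) : IsMorphism ψ := by
  classical
  choose M hM using hψ
  set N : (Fin ((b ++ β.take r₁).length + 1) ⊕ Fin ((β.drop r₁ ++ a).length + 1) →
      GeneralLinearGroup (Fin k) ℂ) → GeneralLinearGroup (Fin k) ℂ :=
    fun m => if hm : flagTuple m ∈
        prodVariety (braidVariety (b ++ β.take r₁)) (braidVariety (β.drop r₁ ++ a)) then M ⟨_, hm⟩ else 1 with hN
  have hNM (m) (hm : flagTuple m ∈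
        prodVariety (braidVariety (b ++ β.take r₁)) (braidVariety (β.drop r₁ ++ a))) : N m = M ⟨_, hm⟩ := dif_pos hm
  have hS (m) (hm : flagTuple m ∈
        prodVariety (braidVariety (b ++ β.take r₁)) (braidVariety (β.drop r₁ ++ a))) :
      IsSpliceTuple β r₁ w a b (N m) (ψ ⟨_, hm⟩).val (flagTuple m) := by
    rw [hNM m hm]
    exact hM _
  have hinl (m : Fin ((b ++ β.take r₁).length + 1) ⊕ Fin ((β.drop r₁ ++ a).length + 1) →
      GeneralLinearGroup (Fin k) ℂ) (j : ℕ) : extendFlags (flagTuple m ∘ Sum.inl) j =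
        flagOf (m (Sum.inl ⟨min j (b ++ β.take r₁).length, by omega⟩)) := rfl
  have hinr (m : Fin ((b ++ β.take r₁).length + 1) ⊕ Fin ((β.drop r₁ ++ a).length + 1) →
      GeneralLinearGroup (Fin k) ℂ) (j : ℕ) : extendFlags (flagTuple m ∘ Sum.inr) j =
        flagOf (m (Sum.inr ⟨min j (β.drop r₁ ++ a).length, by omega⟩)) := rfl
  have hreg : IsLocallyRationalGL {m | flagTuple m ∈
        prodVariety (braidVariety (b ++ β.take r₁)) (braidVariety (β.drop r₁ ++ a))} N := by
    -- The two opposite flags are the junction flag of the second factor and `w₀` times that of the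
    -- first.
    refine isLocallyRationalGL_of_opposite (longest k * w⁻¹)
      (.entry (Sum.inr ⟨min (β.drop r₁).length (β.drop r₁ ++ a).length, by omega⟩))
      (.mul (.const (permGL (longest k)))
        (.entry (Sum.inl ⟨min b.length (b ++ β.take r₁).length, by omega⟩)))
      (fun m hm => (hS m hm).unitLower) (fun m hm => ?_) fun m hm => ?_
    · rw [IsSplice.smul_coordFlag_snd (hS m hm), hinr]
    · rw [IsSplice.smul_coordFlag_fst (hS m hm) hb.1, hinl, smul_flagOf]
  refine isMorphism_of_lift (fun m i => if i ≤ r₁ then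
      (spliceGL w (N m))⁻¹ * permGL (longest k) *
        m (Sum.inl ⟨min (b.length + i) (b ++ β.take r₁).length, by omega⟩)
    else (spliceGL w (N m))⁻¹ *
      m (Sum.inr ⟨min (i - r₁) (β.drop r₁ ++ a).length, by omega⟩)) ?_ ?_
  · intro i
    split_ifs
    · exact ((hreg.spliceGL w).inv.mul (.const _)).mul (.entry _)
    · exact (hreg.spliceGL w).inv.mul (.entry _)
  · intro m hm
    have h := hS m hm
    funext i
    change _ = flagOf (ite _ _ _)
    rw [← extendFlags_val (ψ ⟨_, hm⟩).val i]
    split_ifs with hi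
    · have := h.fst_right i (by rw [length_take_val]; exact hi)
      rw [mul_assoc, ← smul_flagOf, ← smul_flagOf, ← hinl, this, permGL_longest_smul_smul,
        inv_smul_smul]
    · obtain ⟨j, hj⟩ := Nat.exists_eq_add_of_le (Fin.lt_def.mp (not_le.mp hi)).le
      have hi' := i.isLt
      have := h.snd_left j (by rw [length_drop_val]; omega)
      rw [length_take_val, ← hj] at this
      rw [← smul_flagOf, ← hinr, show (i - r₁ : ℕ) = j by omega, this, inv_smul_smul]

/-- The relation `IsSpliceTuple` is the graph of a bijection: it is total and single-valued in both
directions. -/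
theorem exists_splicing_varietyIso (ha : IsReducedWord a w)
    (hb : IsReducedWord b (w⁻¹ * longest k)) :
    ∃ Ψ : VarietyIso
        (prodVariety (braidVariety (b ++ β.take r₁)) (braidVariety (β.drop r₁ ++ a)))
        (splicingLocus β r₁ w),
      ∀ F : splicingLocus β r₁ w, IsSplicingOf β r₁ w a b F.val (Ψ.toEquiv.symm F).val := by
  have hex (F : splicingLocus β r₁ w) :
      ∃ G : prodVariety (braidVariety (b ++ β.take r₁)) (braidVariety (β.drop r₁ ++ a)),
        ∃ N, IsSpliceTuple β r₁ w a b N F.val G.val := by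
    obtain ⟨N, G, hG, h⟩ := exists_isSpliceTuple ha hb F.2
    exact ⟨⟨G, hG⟩, N, h⟩
  choose φ hφ using hex
  have hbij : Function.Bijective φ := by
    refine ⟨fun F F' hFF' => ?_, fun G => ?_⟩
    · obtain ⟨N, h⟩ := hφ F
      obtain ⟨N', h'⟩ := hφ F'
      rw [← hFF'] at h'
      exact Subtype.ext (h.source_eq h' hb)
    · obtain ⟨N, F, hF, h⟩ := exists_isSpliceTuple_of_factors ha hb G.2
      obtain ⟨N', h'⟩ := hφ ⟨F, hF⟩
      exact ⟨⟨F, hF⟩, Subtype.ext (h'.target_eq h)⟩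
  let e := Equiv.ofBijective φ hbij
  have hψ (G) : ∃ N, IsSpliceTuple β r₁ w a b N (e.symm G).val G.val := by
    obtain ⟨N, h⟩ := hφ (e.symm G)
    rw [show φ (e.symm G) = G from e.apply_symm_apply G] at h
    exact ⟨N, h⟩
  refine ⟨⟨e.symm, isMorphism_unsplice hb hψ, isMorphism_splice hφ⟩, fun F => ?_⟩
  obtain ⟨N, h⟩ := hφ F
  exact h.isSplicingOf

end Isomorphism

end BraidSplicing

open BraidSplicing

theorem theorem1p1 (k : ℕ) (β : List (Fin (k - 1))) (hβ : demazure β = longest k)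
    (r₁ : Fin (β.length + 1)) (hr₁ : 1 ≤ (r₁ : ℕ)) :
    (∀ w : Equiv.Perm (Fin k),
      IsPrincipalOpen (braidVariety β) (splicingLocus β r₁ w) ∧
      ∀ a b : List (Fin (k - 1)), IsReducedWord a w → IsReducedWord b (w⁻¹ * longest k) →
        ∃ Ψ : VarietyIso
            (prodVariety (braidVariety (b ++ β.take r₁)) (braidVariety (β.drop r₁ ++ a)))
            (splicingLocus β r₁ w),
          ∀ F : splicingLocus β r₁ w,
            IsSplicingOf β r₁ w a b F.val (Ψ.toEquiv.symm F).val) ∧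
    (⋃ w : Equiv.Perm (Fin k), splicingLocus β r₁ w) = braidVariety β :=
  ⟨fun w => ⟨isPrincipalOpen_splicingLocus β r₁ w,
    fun _ _ ha hb => exists_splicing_varietyIso ha hb⟩, iUnion_splicingLocus β r₁⟩
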